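/- Let $k$ be a field of characteristic $p>0$, let $n\ge 0$, let $R=k[x_1,\dots,x_n]$ with its standard grading, and let $\mathfrak m=(x_1,\dots,x_n)$. Graded $R$-modules are $\mathbb Z$-graded, that is, $M=\bigoplus_{j\in\mathbb Z}M_j$ as abelian groups with $R_iM_j\subseteq M_{i+j}$. A homomorphism $\varphi\colon M\to N$ of graded modules is degree preserving if $\varphi(M_d)\subseteq N_d$ for all $d$. For an $R$-module $M$ let $F(M)=R'\otimes_R M$, where $R'$ is a copy of $R$, made into an $R$-algebra by the Frobenius homomorphism $R\to R'$, $r\mapsto r^p$, and where $R$ acts on $F(M)$ by multiplication on the factor $R'=R$. If $M$ is graded, $F(M)$ is graded by $\deg(r\otimes x)=\deg r+p\cdot\deg x$ for homogeneous $r\in R$, $x\in M$. A graded $F$-module is a graded $R$-module $\mathscr M$ together with a degree preserving $R$-module isomorphism $\theta\colon\mathscr M\to F(\mathscr M)$. A graded module is ${}^*$injective if it is an injective object in the category of graded $R$-modules and degree preserving homomorphisms. A ${}^*$injective hull of a graded module $N$ is a ${}^*$injective graded module $E$ with an injective degree preserving homomorphism $N\to E$ such that every nonzero graded submodule of $E$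 meets the image of $N$ nontrivially. Let ${}^*E$ denote a ${}^*$injective hull of $R/\mathfrak m$ (with the grading induced from $R$), and let ${}^*E(n)$ be ${}^*E$ shifted downward by $n$, that is, ${}^*E(n)_d={}^*E_{n+d}$. **Theorem.** Let $\mathscr M$ be a graded $F$-module supported on $\mathfrak m$, that is, $\operatorname{Supp}_R\mathscr M\subseteq\{\mathfrak m\}$. Then a ${}^*$injective hull ${}^*E$ of $R/\mathfrak m$ exists, and for every such hull ${}^*E$ the graded $R$-module $\mathscr M$ is isomorphic, by a degree preserving isomorphism whose inverse is also degree preserving, to a direct sum of a (possibly infinite, possibly zero) number of copies of ${}^*E(n)$. -/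

import Mathlib

open scoped TensorProduct DirectSum

universe u v w

section FrobeniusFunctor

/-- The target copy `R'` of the Frobenius homomorphism `R → R'`, `r ↦ r ^ p`: the ring `R` itself,
regarded as an `R`-algebra through Frobenius (see the instance below). -/
def FrobeniusTarget (R : Type u) (_p : ℕ) : Type u := R

variable (R : Type u) [CommRing R] (p : ℕ)

instance FrobeniusTarget.instCommRing : CommRing (FrobeniusTarget R p) :=
  inferInstanceAs (CommRing R)

/-- `R` and its copy `R'` are the same ring. -/
def FrobeniusTarget.of : R ≃+* FrobeniusTarget R p := RingEquiv.refl R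

variable [ExpChar R p]

noncomputable instance FrobeniusTarget.instAlgebra : Algebra R (FrobeniusTarget R p) :=
  ((FrobeniusTarget.of R p).toRingHom.comp (frobenius R p)).toAlgebra

variable (M : Type v) [AddCommGroup M] [Module R M]

/-- The Frobenius functor on objects: `F(M) = R' ⊗[R] M`. -/
def FrobeniusPullback : Type (max u v) := FrobeniusTarget R p ⊗[R] M

noncomputable instance FrobeniusPullback.instAddCommGroup :
    AddCommGroup (FrobeniusPullback R p M) :=
  inferInstanceAs (AddCommGroup (FrobeniusTarget R p ⊗[R] M))

/-- `F(M)` is an `R`-module by multiplication on the left tensor factor: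
`r • (s ⊗ x) = (r * s) ⊗ x`. -/
noncomputable instance FrobeniusPullback.instModule : Module R (FrobeniusPullback R p M) :=
  letI : Module (FrobeniusTarget R p) (FrobeniusPullback R p M) :=
    inferInstanceAs (Module (FrobeniusTarget R p) (FrobeniusTarget R p ⊗[R] M))
  Module.compHom (FrobeniusPullback R p M) (FrobeniusTarget.of R p).toRingHom

variable {R M}

/-- The pure tensor `r ⊗ x` in `F(M) = R' ⊗[R] M`. -/
noncomputable def FrobeniusPullback.tmul (r : R) (x : M) : FrobeniusPullback R p M :=
  (FrobeniusTarget.of R p r) ⊗ₜ[R] x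

end FrobeniusFunctor

section Graded

variable (k : Type u) [Field k] (n : ℕ)

/-- The family of subgroups `ℳ` makes `M` a graded module over the standard graded polynomial ring
`k[x_1, …, x_n]`: `M = ⨁_{j ∈ ℤ} M_j` and `R_i M_j ⊆ M_{i+j}`. -/
structure IsGradedModule {M : Type v} [AddCommGroup M] [Module (MvPolynomial (Fin n) k) M]
    (ℳ : ℤ → AddSubgroup M) : Prop where
  isInternal : DirectSum.IsInternal ℳ
  smul_mem : ∀ (i : ℕ) (j : ℤ) (r : MvPolynomial (Fin n) k) (x : M),
    r ∈ MvPolynomial.homogeneousSubmodule (Fin n) k i → x ∈ ℳ j → r • x ∈ ℳ ((i : ℤ) + j)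

variable {k n}

/-- A linear map `φ` is degree preserving: `φ(M_d) ⊆ N_d` for all `d`. -/
def IsDegreePreserving {M : Type v} {N : Type w} [AddCommGroup M]
    [Module (MvPolynomial (Fin n) k) M] [AddCommGroup N] [Module (MvPolynomial (Fin n) k) N]
    (ℳ : ℤ → AddSubgroup M) (𝒩 : ℤ → AddSubgroup N)
    (φ : M →ₗ[MvPolynomial (Fin n) k] N) : Prop :=
  ∀ (d : ℤ) (x : M), x ∈ ℳ d → φ x ∈ 𝒩 d

/-- The grading of `F(M)` determined by `deg (r ⊗ x) = deg r + p * deg x`. -/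
noncomputable def frobeniusGrading (p : ℕ) [ExpChar (MvPolynomial (Fin n) k) p]
    {M : Type v} [AddCommGroup M] [Module (MvPolynomial (Fin n) k) M]
    (ℳ : ℤ → AddSubgroup M) (d : ℤ) :
    AddSubgroup (FrobeniusPullback (MvPolynomial (Fin n) k) p M) :=
  AddSubgroup.closure
    {y | ∃ (i : ℕ) (j : ℤ) (r : MvPolynomial (Fin n) k) (x : M),
      r ∈ MvPolynomial.homogeneousSubmodule (Fin n) k i ∧ x ∈ ℳ j ∧
      (i : ℤ) + (p : ℤ) * j = d ∧ FrobeniusPullback.tmul p r x = y}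

variable (k n) in
/-- A graded `F`-module structure on `(M, ℳ)`: `M` is a graded module, together with a degree
preserving structure isomorphism `θ : M → F(M)`. -/
structure GradedFModuleStructure (p : ℕ) [ExpChar (MvPolynomial (Fin n) k) p]
    {M : Type v} [AddCommGroup M] [Module (MvPolynomial (Fin n) k) M]
    (ℳ : ℤ → AddSubgroup M) where
  isGradedModule : IsGradedModule k n ℳ
  θ : M ≃ₗ[MvPolynomial (Fin n) k] FrobeniusPullback (MvPolynomial (Fin n) k) p M
  degreePreserving : IsDegreePreserving ℳ (frobeniusGrading p ℳ) θ.toLinearMap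

/-- The shifted grading: `M(t)_d = M_{t+d}`. -/
def shiftGrading {M : Type v} [AddCommGroup M] (ℳ : ℤ → AddSubgroup M) (t : ℤ) :
    ℤ → AddSubgroup M :=
  fun d => ℳ (t + d)

/-- The grading of a direct sum of copies of a graded module: an element has degree `d` when all of
its components do. -/
def directSumGrading (ι : Type w) {M : Type v} [AddCommGroup M] (ℳ : ℤ → AddSubgroup M) (d : ℤ) :
    AddSubgroup (⨁ _ : ι, M) where
  carrier := {x | ∀ i, x i ∈ ℳ d}
  zero_mem' := fun i => by simp
  add_mem' := fun {x y} hx hy i => by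
    rw [DirectSum.add_apply]
    exact (ℳ d).add_mem (hx i) (hy i)
  neg_mem' := fun {x} hx i => by
    have h : (-x) i = -(x i) := DFinsupp.neg_apply x i
    rw [h]
    exact (ℳ d).neg_mem (hx i)

/-- A submodule is graded if it is the sum of its intersections with the graded pieces. -/
def IsGradedSubmodule {M : Type v} [AddCommGroup M] [Module (MvPolynomial (Fin n) k) M]
    (ℳ : ℤ → AddSubgroup M) (U : Submodule (MvPolynomial (Fin n) k) M) : Prop :=
  U.toAddSubgroup = ⨆ d : ℤ, U.toAddSubgroup ⊓ ℳ d

variable (k n) in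
/-- A graded module `E` is `*`injective: it is an injective object in the category of graded modules
and degree preserving homomorphisms. -/
def IsStarInjective {E : Type w} [AddCommGroup E] [Module (MvPolynomial (Fin n) k) E]
    (ℰ : ℤ → AddSubgroup E) : Prop :=
  ∀ (A B : Type (max u w)) [AddCommGroup A] [Module (MvPolynomial (Fin n) k) A]
    [AddCommGroup B] [Module (MvPolynomial (Fin n) k) B]
    (𝒜 : ℤ → AddSubgroup A) (ℬ : ℤ → AddSubgroup B),
    IsGradedModule k n 𝒜 → IsGradedModule k n ℬ →
    ∀ (f : A →ₗ[MvPolynomial (Fin n) k] B) (g : A →ₗ[MvPolynomial (Fin n) k] E),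
      IsDegreePreserving 𝒜 ℬ f → Function.Injective f → IsDegreePreserving 𝒜 ℰ g →
      ∃ h : B →ₗ[MvPolynomial (Fin n) k] E, IsDegreePreserving ℬ ℰ h ∧ h ∘ₗ f = g

/-- The degree preserving map `j : N → E` exhibits the graded module `E` as a `*`injective hull of
the graded module `N`: `E` is `*`injective, `j` is injective, and `E` is a `*`essential extension of
`N`, that is, every nonzero graded submodule of `E` meets the image of `N` nontrivially. -/
structure IsStarInjectiveHull {N : Type v} {E : Type w}
    [AddCommGroup N] [Module (MvPolynomial (Fin n) k) N]
    [AddCommGroup E] [Module (MvPolynomial (Fin n) k) E]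
    (𝒩 : ℤ → AddSubgroup N) (ℰ : ℤ → AddSubgroup E)
    (j : N →ₗ[MvPolynomial (Fin n) k] E) : Prop where
  isGradedModule : IsGradedModule k n ℰ
  starInjective : IsStarInjective k n ℰ
  degreePreserving : IsDegreePreserving 𝒩 ℰ j
  injective : Function.Injective j
  essential : ∀ U : Submodule (MvPolynomial (Fin n) k) E,
    IsGradedSubmodule ℰ U → U ≠ ⊥ → U ⊓ LinearMap.range j ≠ ⊥

variable (k n)

/-- The maximal homogeneous ideal `𝔪 = (x_1, …, x_n)`. -/
noncomputable def irrelevantIdeal : Ideal (MvPolynomial (Fin n) k) :=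
  Ideal.span (Set.range MvPolynomial.X)

/-- The grading of `R/𝔪` induced from `R`: the degree `d` part is the image of the homogeneous
polynomials of degree `d` (it vanishes for negative `d`). -/
noncomputable def residueGrading (d : ℤ) : AddSubgroup (MvPolynomial (Fin n) k ⧸ irrelevantIdeal k n) :=
  AddSubgroup.closure
    {y | ∃ (i : ℕ) (r : MvPolynomial (Fin n) k),
      r ∈ MvPolynomial.homogeneousSubmodule (Fin n) k i ∧ (i : ℤ) = d ∧
      Ideal.Quotient.mk (irrelevantIdeal k n) r = y}

/-- The graded module `(E, ℰ)` is a `*`injective hull `*E` of `R/𝔪`. -/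
def IsStarE {E : Type w} [AddCommGroup E] [Module (MvPolynomial (Fin n) k) E]
    (ℰ : ℤ → AddSubgroup E) : Prop :=
  ∃ j : (MvPolynomial (Fin n) k ⧸ irrelevantIdeal k n) →ₗ[MvPolynomial (Fin n) k] E,
    IsStarInjectiveHull (residueGrading k n) ℰ j

end Graded

/-!
Let `R = k[x_1, …, x_n]`. The `*`injective hull of `R/𝔪` is the module `k[x_1⁻¹, …, x_n⁻¹]` of
inverse polynomials: a degree preserving map `g` into it is determined by the functional
`x ↦ g(x)(0)` (`InversePolynomial.coind`), and functionals over a field extend. Any other hull is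
isomorphic to this one (`IsStarE.exists_equiv`).

Let `M` be a graded `F`-module supported on `𝔪`, and call socle the set of elements annihilated by
all variables. In terms of a basis of `k` over its subfield of `p`-th powers and of the monomials
`xᵃ` with `a < p`, each element of `F(M)` has coordinates in `M`
(`FrobeniusPullback.exists_sum_coord`). For a socle element of `F(M)` the only nonzero coordinates
are those at `a = (p - 1, …, p - 1)`, and these lie in the socle of `M`. Two facts follow.

* As `M ≅ F(M)`, a degree `e` in which the socle of `M` is nonzero gives another such degree `j`
  with `e + n = p (j + n)`; by descent on `|e + n|` the socle lives in degree `-n`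
  (`GradedFModuleStructure.degree_eq_of_X_smul_eq_zero`).
* If every socle element `v` is of the form `xᵇ m`, where `m` is annihilated by all other monomials
  of degree at least `|b|`, then the same holds for the exponent `p b + (p - 1, …, p - 1)`. As these
  exponents become arbitrarily large, the statement holds for all `b`
  (`GradedFModuleStructure.exists_isMonomialLift`).

A `k`-linear projection of `M` onto its socle `V` coinduces a map from `M` to the inverse polynomials with
coefficients in `V`, shifted by `n`. It is injective because every nonzero submodule of `M` meets
the socle, and surjective by the second fact. A basis of `V` splits the target into copies of
`k[x_1⁻¹, …, x_n⁻¹]`.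
-/

/-! ### Projections of graded modules -/

section GradedModules

open MvPolynomial

variable {k : Type u} [Field k] {n : ℕ}

/-- The projection of a graded module onto its piece of degree `d`. -/
noncomputable def IsGradedModule.proj {M : Type v} [AddCommGroup M]
    [Module (MvPolynomial (Fin n) k) M] {ℳ : ℤ → AddSubgroup M} (h : IsGradedModule k n ℳ) (d : ℤ) :
    M →+ M :=
  (ℳ d).subtype.comp ((DFinsupp.evalAddMonoidHom d).comp
    (AddEquiv.ofBijective (DirectSum.coeAddMonoidHom ℳ) h.isInternal).symm.toAddMonoidHom)

namespace IsGradedModule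

variable {M : Type v} [AddCommGroup M] [Module (MvPolynomial (Fin n) k) M]
  {ℳ : ℤ → AddSubgroup M} (h : IsGradedModule k n ℳ)

include h

theorem proj_mem (d : ℤ) (x : M) : h.proj d x ∈ ℳ d := by
  simp only [proj, AddMonoidHom.comp_apply]
  exact Subtype.property _

theorem proj_of_mem {d : ℤ} {x : M} (hx : x ∈ ℳ d) (e : ℤ) :
    h.proj e x = if e = d then x else 0 := by
  have hs : (AddEquiv.ofBijective (DirectSum.coeAddMonoidHom ℳ) h.isInternal).symm x
      = DirectSum.of (fun i => ℳ i) d ⟨x, hx⟩ := by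
    rw [AddEquiv.symm_apply_eq]
    exact (DirectSum.coeAddMonoidHom_of ℳ d ⟨x, hx⟩).symm
  have : h.proj e x = ((DirectSum.of (fun i => ℳ i) d ⟨x, hx⟩) e : ℳ e) := by
    rw [← hs]; rfl
  rw [this]
  split_ifs with hed
  · subst hed; rw [DirectSum.of_eq_same]
  · rw [DirectSum.of_eq_of_ne _ _ _ hed]; rfl

theorem proj_same {d : ℤ} {x : M} (hx : x ∈ ℳ d) : h.proj d x = x := by
  rw [h.proj_of_mem hx, if_pos rfl]

theorem proj_ne {d e : ℤ} {x : M} (hx : x ∈ ℳ d) (hde : e ≠ d) : h.proj e x = 0 := by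
  rw [h.proj_of_mem hx, if_neg hde]

theorem iSup_eq_top : ⨆ d, ℳ d = ⊤ := by
  rw [eq_top_iff]
  intro x _
  obtain ⟨a, rfl⟩ := h.isInternal.2 x
  induction a using DirectSum.induction_on with
  | zero => rw [map_zero]; exact zero_mem _
  | of d y =>
    rw [DirectSum.coeAddMonoidHom_of]
    exact AddSubgroup.mem_iSup_of_mem d y.2
  | add a b ha hb => rw [map_add]; exact add_mem (ha trivial) (hb trivial)

@[elab_as_elim]
theorem induction {P : M → Prop} (x : M) (hom : ∀ d, ∀ y ∈ ℳ d, P y)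
    (add : ∀ y z, P y → P z → P (y + z)) : P x := by
  have hx : x ∈ ⨆ d, ℳ d := by rw [h.iSup_eq_top]; trivial
  exact AddSubgroup.iSup_induction ℳ (C := P) hx hom (hom 0 0 (ℳ 0).zero_mem) add

theorem exists_sum (x : M) : ∃ S : Finset ℤ, (∀ d, d ∉ S → h.proj d x = 0) ∧
    x = ∑ d ∈ S, h.proj d x := by
  classical
  suffices H : ∃ S : Finset ℤ, ∀ T, S ⊆ T →
      (∀ d, d ∉ T → h.proj d x = 0) ∧ x = ∑ d ∈ T, h.proj d x by
    obtain ⟨S, hS⟩ := H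
    exact ⟨S, hS S subset_rfl⟩
  refine h.induction x (fun d y hy => ⟨{d}, fun T hT => ?_⟩) ?_
  · have hd : d ∈ T := hT (Finset.mem_singleton_self d)
    simp only [h.proj_of_mem hy]
    refine ⟨fun e he => if_neg fun H : e = d => he (H ▸ hd), ?_⟩
    rw [Finset.sum_ite_eq' T d, if_pos hd]
  · rintro y z ⟨S, hS⟩ ⟨S', hS'⟩
    refine ⟨S ∪ S', fun T hT => ?_⟩
    have h1 := hS T (Finset.union_subset_left hT)
    have h2 := hS' T (Finset.union_subset_right hT)
    refine ⟨fun d hd => by rw [map_add, h1.1 d hd, h2.1 d hd, add_zero], ?_⟩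
    simp only [map_add, Finset.sum_add_distrib]
    rw [← h1.2, ← h2.2]

theorem ext_proj {x y : M} (hxy : ∀ d, h.proj d x = h.proj d y) : x = y := by
  rw [← sub_eq_zero]
  obtain ⟨S, -, hS⟩ := h.exists_sum (x - y)
  rw [hS]
  exact Finset.sum_eq_zero fun d _ => by rw [map_sub, hxy, sub_self]

theorem proj_smul {i : ℕ} {r : MvPolynomial (Fin n) k} (hr : r ∈ homogeneousSubmodule (Fin n) k i)
    {d e : ℤ} (hde : i + d = e) (x : M) : h.proj e (r • x) = r • h.proj d x := by
  refine h.induction x (fun j y hy => ?_) fun y z hy hz => by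
    rw [smul_add, map_add, map_add, hy, hz, smul_add]
  rw [h.proj_of_mem (h.smul_mem i j r y hr hy), h.proj_of_mem hy]
  by_cases hj : d = j
  · rw [if_pos hj, if_pos (by omega)]
  · rw [if_neg hj, if_neg (by omega), smul_zero]

theorem monomial_smul_mem (a : Fin n →₀ ℕ) (c : k) {d : ℤ} {x : M} (hx : x ∈ ℳ d) :
    (monomial a c : MvPolynomial (Fin n) k) • x ∈ ℳ (a.degree + d) :=
  h.smul_mem _ _ _ _ (isHomogeneous_monomial c rfl) hx

theorem proj_monomial_smul (a : Fin n →₀ ℕ) (c : k) (e : ℤ) (x : M) :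
    h.proj e ((monomial a c : MvPolynomial (Fin n) k) • x) =
      (monomial a c : MvPolynomial (Fin n) k) • h.proj (e - a.degree) x :=
  h.proj_smul (isHomogeneous_monomial c rfl) (by ring) x

omit h in
/-- A family of subgroups that is respected by scalars is a grading as soon as it generates the
module and admits projections onto its members. -/
theorem of_proj (p : ℤ → M →+ M)
    (hp : ∀ d e x, x ∈ ℳ d → p e x = if e = d then x else 0) (htop : ⨆ d, ℳ d = ⊤)
    (hsmul : ∀ (i : ℕ) (j : ℤ) (r : MvPolynomial (Fin n) k) (x : M),
      r ∈ homogeneousSubmodule (Fin n) k i → x ∈ ℳ j → r • x ∈ ℳ ((i : ℤ) + j)) :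
    IsGradedModule k n ℳ := by
  refine ⟨⟨?_, ?_⟩, hsmul⟩
  · rw [injective_iff_map_eq_zero]
    intro f hf
    have key : ∀ (e : ℤ) (g : ⨁ d, ℳ d), p e (DirectSum.coeAddMonoidHom ℳ g) = (g e : M) := by
      intro e g
      induction g using DirectSum.induction_on with
      | zero => simp
      | of d x =>
        rw [DirectSum.coeAddMonoidHom_of, hp d e _ x.2]
        split_ifs with hed
        · subst hed; rw [DirectSum.of_eq_same]
        · rw [DirectSum.of_eq_of_ne _ _ _ hed]; rfl
      | add x y hx hy => rw [map_add, map_add, hx, hy, DirectSum.add_apply]; rfl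
    ext e
    rw [← key, hf, map_zero]; rfl
  · intro x
    have hx : x ∈ ⨆ d, ℳ d := by rw [htop]; trivial
    refine AddSubgroup.iSup_induction ℳ (C := fun x => ∃ a, DirectSum.coeAddMonoidHom ℳ a = x) hx
      (fun d y hy => ⟨DirectSum.of (fun i => ℳ i) d ⟨y, hy⟩, DirectSum.coeAddMonoidHom_of ℳ d _⟩)
      ⟨0, map_zero _⟩ ?_
    rintro y z ⟨a, rfl⟩ ⟨b, rfl⟩
    exact ⟨a + b, map_add _ _ _⟩

variable {N : Type w} [AddCommGroup N] [Module (MvPolynomial (Fin n) k) N]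

theorem comap_equiv (e : N ≃ₗ[MvPolynomial (Fin n) k] M) :
    IsGradedModule k n fun d => (ℳ d).comap e.toLinearMap.toAddMonoidHom := by
  refine of_proj (fun d => e.symm.toLinearMap.toAddMonoidHom.comp
    ((h.proj d).comp e.toLinearMap.toAddMonoidHom)) ?_ ?_ ?_
  · intro d d' x hx
    change e.symm (h.proj d' (e x)) = _
    rw [h.proj_of_mem (show e x ∈ ℳ d from hx)]
    split_ifs <;> simp
  · rw [eq_top_iff]
    intro x _
    obtain ⟨S, -, hS⟩ := h.exists_sum (e x)
    have : x = ∑ d ∈ S, e.symm (h.proj d (e x)) := by rw [← map_sum, ← hS, e.symm_apply_apply]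
    rw [this]
    refine sum_mem fun d _ => AddSubgroup.mem_iSup_of_mem d ?_
    change e (e.symm (h.proj d (e x))) ∈ ℳ d
    rw [e.apply_symm_apply]
    exact h.proj_mem d _
  · intro i j r x hr hx
    change e (r • x) ∈ ℳ (i + j)
    rw [map_smul]
    exact h.smul_mem i j r _ hr hx

variable {𝒩 : ℤ → AddSubgroup N} (hN : IsGradedModule k n 𝒩)

include hN

theorem map_proj {φ : M →ₗ[MvPolynomial (Fin n) k] N} (hφ : IsDegreePreserving ℳ 𝒩 φ) (d : ℤ)
    (x : M) : φ (h.proj d x) = hN.proj d (φ x) := by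
  refine h.induction x (fun e y hy => ?_) fun y z hy hz => by simp only [map_add, hy, hz]
  rw [h.proj_of_mem hy, hN.proj_of_mem (hφ e y hy)]
  split_ifs <;> simp

theorem mem_iff_of_injective {φ : M →ₗ[MvPolynomial (Fin n) k] N}
    (hφ : IsDegreePreserving ℳ 𝒩 φ) (hinj : Function.Injective φ) (d : ℤ) (x : M) :
    x ∈ ℳ d ↔ φ x ∈ 𝒩 d := by
  refine ⟨hφ d x, fun hx => ?_⟩
  have : φ (h.proj d x) = φ x := by rw [h.map_proj hN hφ, hN.proj_same hx]
  rw [← hinj this]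
  exact h.proj_mem d x

theorem isGradedSubmodule_ker {φ : M →ₗ[MvPolynomial (Fin n) k] N}
    (hφ : IsDegreePreserving ℳ 𝒩 φ) : IsGradedSubmodule ℳ (LinearMap.ker φ) := by
  refine le_antisymm (fun x hx => ?_) (iSup_le fun d => inf_le_left)
  obtain ⟨S, -, hS⟩ := h.exists_sum x
  rw [hS]
  refine sum_mem fun d _ => AddSubgroup.mem_iSup_of_mem d ⟨?_, h.proj_mem d x⟩
  change φ _ = 0
  rw [h.map_proj hN hφ, show φ x = 0 from hx, map_zero]

end IsGradedModule

/-- A nonzero element on which every variable acts nilpotently has a nonzero multiple annihilated by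
all variables. -/
theorem exists_smul_ne_zero_X_smul_eq_zero {M : Type v} [AddCommGroup M]
    [Module (MvPolynomial (Fin n) k) M] {x : M} (hx : x ≠ 0)
    (hnil : ∀ i, ∃ N : ℕ, (X i : MvPolynomial (Fin n) k) ^ N • x = 0) :
    ∃ r : MvPolynomial (Fin n) k, r • x ≠ 0 ∧
      ∀ i, (X i : MvPolynomial (Fin n) k) • r • x = 0 := by
  classical
  suffices H : ∀ S : Finset (Fin n), ∃ r : MvPolynomial (Fin n) k, r • x ≠ 0 ∧
      ∀ i ∈ S, (X i : MvPolynomial (Fin n) k) • r • x = 0 by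
    obtain ⟨r, h1, h2⟩ := H Finset.univ
    exact ⟨r, h1, fun i => h2 i (Finset.mem_univ i)⟩
  intro S
  induction S using Finset.induction_on with
  | empty => exact ⟨1, by simpa using hx, by simp⟩
  | insert i S _ ih =>
    obtain ⟨r, h1, h2⟩ := ih
    have hex : ∃ N : ℕ, (X i : MvPolynomial (Fin n) k) ^ N • r • x = 0 := by
      obtain ⟨N, hN⟩ := hnil i
      exact ⟨N, by rw [smul_comm, hN, smul_zero]⟩
    obtain ⟨N, hN⟩ : ∃ N, Nat.find hex = N + 1 :=
      Nat.exists_eq_succ_of_ne_zero fun h0 => h1 (by simpa [h0] using Nat.find_spec hex)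
    refine ⟨X i ^ N * r, ?_, fun j hj => ?_⟩
    · rw [mul_smul]
      exact Nat.find_min hex (by omega)
    · rcases Finset.mem_insert.mp hj with rfl | hj
      · have := Nat.find_spec hex
        rwa [hN, pow_succ', mul_smul, ← mul_smul (X j ^ N)] at this
      · rw [mul_smul, smul_comm, h2 j hj, smul_zero]

end GradedModules

/-! ### Inverse polynomials -/

section InversePolynomials

open MvPolynomial

/-- The module of inverse polynomials `V[x_1⁻¹, …, x_n⁻¹]` with coefficients in `V`: the value of
`f` at `a` is the coefficient of `x⁻ᵃ`. -/
def InversePolynomial (n : ℕ) (V : Type v) [Zero V] : Type v := (Fin n →₀ ℕ) →₀ V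

namespace InversePolynomial

variable {k : Type u} [Field k] {n : ℕ} {V : Type v} [AddCommGroup V] [Module k V]

noncomputable instance : AddCommGroup (InversePolynomial n V) :=
  inferInstanceAs (AddCommGroup ((Fin n →₀ ℕ) →₀ V))

noncomputable instance : Module k (InversePolynomial n V) :=
  inferInstanceAs (Module k ((Fin n →₀ ℕ) →₀ V))

/-- The coefficient of `x⁻ᵃ`. -/
def coeff (a : Fin n →₀ ℕ) : InversePolynomial n V →+ V := Finsupp.applyAddHom a

/-- The inverse monomial `v x⁻ᵃ`. -/
noncomputable def single (a : Fin n →₀ ℕ) : V →+ InversePolynomial n V := Finsupp.singleAddHom a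

theorem ext {f g : InversePolynomial n V} (h : ∀ a, coeff a f = coeff a g) : f = g :=
  Finsupp.ext h

theorem coeff_single (a b : Fin n →₀ ℕ) (v : V) :
    coeff a (single b v) = if a = b then v else 0 := by
  classical
  refine (Finsupp.single_apply).trans ?_
  simp only [eq_comm]

theorem coeff_single_same (a : Fin n →₀ ℕ) (v : V) : coeff a (single a v) = v := by
  rw [coeff_single, if_pos rfl]

@[elab_as_elim]
theorem induction {P : InversePolynomial n V → Prop} (f : InversePolynomial n V)
    (single : ∀ a v, P (single a v)) (add : ∀ f g, P f → P g → P (f + g)) : P f :=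
  Finsupp.induction_linear f
    ((map_zero (InversePolynomial.single (0 : Fin n →₀ ℕ) (V := V))) ▸ single 0 0) add single

/-- Multiplication by the monomial `xᵇ`, as a linear endomorphism. -/
noncomputable def shift (k : Type u) [Field k] [Module k V] (b : Fin n →₀ ℕ) :
    Module.End k (InversePolynomial n V) :=
  Finsupp.lcomapDomain (fun a => a + b) (add_left_injective b)

theorem coeff_shift (a b : Fin n →₀ ℕ) (f : InversePolynomial n V) :
    coeff a (shift k b f) = coeff (a + b) f := rfl

/-- The polynomial ring acts on inverse polynomials by lowering exponents, where monomials
outside of the range of inverse monomials are zero. -/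
noncomputable def action (k : Type u) [Field k] (n : ℕ) (V : Type v) [AddCommGroup V] [Module k V] :
    MvPolynomial (Fin n) k →ₐ[k] Module.End k (InversePolynomial n V) :=
  AddMonoidAlgebra.lift k (Module.End k (InversePolynomial n V)) (Fin n →₀ ℕ)
    { toFun := fun b => shift k b.toAdd
      map_one' := LinearMap.ext fun f => ext fun a => by
        rw [coeff_shift, toAdd_one, add_zero]; rfl
      map_mul' := fun b c => LinearMap.ext fun f => ext fun a => by
        rw [Module.End.mul_apply, coeff_shift, coeff_shift, coeff_shift, toAdd_mul, add_assoc] }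

noncomputable instance : Module (MvPolynomial (Fin n) k) (InversePolynomial n V) :=
  Module.compHom _ (action k n V).toRingHom

theorem coeff_monomial_smul (a b : Fin n →₀ ℕ) (c : k) (f : InversePolynomial n V) :
    coeff a ((monomial b c : MvPolynomial (Fin n) k) • f) = c • coeff (a + b) f := by
  change coeff a (action k n V (monomial b c) f) = _
  have : action k n V (monomial b c) = c • shift k b := by
    refine (AddMonoidAlgebra.lift_single _ _ _).trans ?_
    rfl
  rw [this]
  rfl

theorem monomial_smul_single (b a : Fin n →₀ ℕ) (c : k) (v : V) :
    (monomial b c : MvPolynomial (Fin n) k) • single a v =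
      if b ≤ a then single (a - b) (c • v) else 0 := by
  refine ext fun e => ?_
  rw [coeff_monomial_smul, coeff_single]
  split_ifs with h1 h2 h2
  · rw [coeff_single, if_pos (by rw [← h1, add_tsub_cancel_right])]
  · exact absurd (h1 ▸ le_add_self) h2
  · rw [coeff_single, if_neg, smul_zero]
    rintro rfl
    exact h1 (tsub_add_cancel_of_le h2)
  · rw [smul_zero, map_zero]

/-- Additive maps that commute with the action of monomials are linear. -/
theorem _root_.MvPolynomial.map_smul_of_map_monomial_smul {A : Type v} {B : Type w}
    [AddCommGroup A] [Module (MvPolynomial (Fin n) k) A] [AddCommGroup B]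
    [Module (MvPolynomial (Fin n) k) B] (f : A →+ B)
    (h : ∀ (a : Fin n →₀ ℕ) (c : k) (x : A), f ((monomial a c : MvPolynomial (Fin n) k) • x) =
      (monomial a c : MvPolynomial (Fin n) k) • f x) (r : MvPolynomial (Fin n) k) (x : A) :
    f (r • x) = r • f x := by
  induction r using MvPolynomial.induction_on' with
  | monomial a c => exact h a c x
  | add p q hp hq => rw [add_smul, add_smul, map_add, hp, hq]

theorem X_pow_smul_eq_zero (i : Fin n) (f : InversePolynomial n V) :
    ∃ N : ℕ, (X i : MvPolynomial (Fin n) k) ^ N • f = 0 := by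
  refine induction f (fun a v => ⟨a i + 1, ?_⟩) ?_
  · rw [X_pow_eq_monomial, monomial_smul_single, if_neg]
    intro h
    have := h i
    simp at this
  · rintro f g ⟨N, hN⟩ ⟨N', hN'⟩
    refine ⟨N + N', ?_⟩
    rw [smul_add, pow_add, mul_smul, mul_smul, hN', smul_zero, add_zero, smul_comm, hN, smul_zero]

theorem eq_single_zero_of_X_smul_eq_zero {f : InversePolynomial n V}
    (hf : ∀ i, (X i : MvPolynomial (Fin n) k) • f = 0) : f = single 0 (coeff 0 f) := by
  refine ext fun a => ?_
  rw [coeff_single]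
  split_ifs with ha
  · rw [ha]
  · obtain ⟨i, hi⟩ : ∃ i, a i ≠ 0 := by
      by_contra! H
      exact ha (Finsupp.ext H)
    have h1 : a = (a - Finsupp.single i 1) + Finsupp.single i 1 :=
      (tsub_add_cancel_of_le (by
        rw [Finsupp.single_le_iff]; omega)).symm
    have h2 := congrArg (coeff (a - Finsupp.single i 1)) (hf i)
    rw [X, coeff_monomial_smul, one_smul, ← h1, map_zero] at h2
    exact h2

theorem X_smul_single_zero (i : Fin n) (v : V) :
    (X i : MvPolynomial (Fin n) k) • (single 0 v : InversePolynomial n V) = 0 := by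
  rw [X, monomial_smul_single, if_neg]
  intro h
  have := h i
  simp at this

/-- Every nonzero submodule of the inverse polynomials contains a nonzero constant. -/
theorem exists_single_zero_mem {U : Submodule (MvPolynomial (Fin n) k) (InversePolynomial n V)}
    (hU : U ≠ ⊥) : ∃ v : V, v ≠ 0 ∧ single 0 v ∈ U := by
  obtain ⟨f, hf, hf0⟩ := U.ne_bot_iff.mp hU
  obtain ⟨r, hr, hX⟩ := exists_smul_ne_zero_X_smul_eq_zero hf0
    fun i => X_pow_smul_eq_zero (k := k) i f
  have := eq_single_zero_of_X_smul_eq_zero hX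
  refine ⟨coeff 0 (r • f), fun h0 => hr ?_, this ▸ U.smul_mem r hf⟩
  rw [this, h0, map_zero]

/-- The grading of the inverse polynomials in which `x⁻ᵃ` has degree `-|a|`. -/
noncomputable def grading (n : ℕ) (V : Type v) [AddCommGroup V] (d : ℤ) :
    AddSubgroup (InversePolynomial n V) where
  carrier := {f | ∀ a : Fin n →₀ ℕ, -(a.degree : ℤ) ≠ d → coeff a f = 0}
  zero_mem' := fun a _ => map_zero _
  add_mem' := fun {f g} hf hg a ha => by rw [map_add, hf a ha, hg a ha, add_zero]
  neg_mem' := fun {f} hf a ha => by rw [map_neg, hf a ha, neg_zero]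

theorem mem_grading {d : ℤ} {f : InversePolynomial n V} :
    f ∈ grading n V d ↔ ∀ a : Fin n →₀ ℕ, -(a.degree : ℤ) ≠ d → coeff a f = 0 := Iff.rfl

theorem single_mem_grading (a : Fin n →₀ ℕ) (v : V) :
    single a v ∈ grading n V (-(a.degree : ℤ)) := fun b hb => by
  rw [coeff_single, if_neg]
  rintro rfl
  exact hb rfl

theorem isGradedModule (k : Type u) [Field k] (n : ℕ) (V : Type v) [AddCommGroup V] [Module k V] :
    IsGradedModule k n (grading n V) := by
  refine .of_proj (fun d => Finsupp.filterAddHom fun a : Fin n →₀ ℕ => -(a.degree : ℤ) = d)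
    ?_ ?_ ?_
  · intro d e f hf
    refine ext fun a => ?_
    refine (Finsupp.filter_apply (p := fun a : Fin n →₀ ℕ => -(a.degree : ℤ) = e) f a).trans ?_
    by_cases hed : e = d
    · subst hed
      rw [if_pos rfl]
      split_ifs with h
      · rfl
      · exact (hf a h).symm
    · rw [if_neg hed, map_zero]
      split_ifs with h
      · exact hf a (h ▸ hed)
      · rfl
  · rw [eq_top_iff]
    intro f _
    exact induction f (fun a v => AddSubgroup.mem_iSup_of_mem _ (single_mem_grading a v))
      fun f g hf hg => add_mem hf hg
  · intro i j r f hr hf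
    rw [r.as_sum, Finset.sum_smul]
    refine sum_mem fun b hb => ?_
    have hi : b.degree = i := by
      rw [mem_homogeneousSubmodule] at hr
      by_contra H
      exact (MvPolynomial.mem_support_iff.mp hb) (hr.coeff_eq_zero H)
    intro a ha
    rw [coeff_monomial_smul, hf, smul_zero]
    rw [map_add]
    push_cast
    omega

variable {B : Type w} [AddCommGroup B] [Module (MvPolynomial (Fin n) k) B]
  {ℬ : ℤ → AddSubgroup B} (hB : IsGradedModule k n ℬ) (β : B →+ V)
  (hβ : ∀ (c : k) (x : B), β ((C c : MvPolynomial (Fin n) k) • x) = c • β x) (t : ℤ)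

omit [Module k V] in
/-- Only finitely many components of `x` are nonzero, and each of them reaches degree `t` under
multiplication by finitely many monomials. -/
theorem finite_proj_monomial_smul_ne_zero (x : B) :
    {a : Fin n →₀ ℕ | β (hB.proj t ((monomial a (1 : k)) • x)) ≠ 0}.Finite := by
  obtain ⟨S, hS, -⟩ := hB.exists_sum x
  refine (Set.Finite.biUnion S.finite_toSet
    fun d _ => Finsupp.finite_of_degree_le (σ := Fin n) (t - d).toNat).subset fun a ha => ?_
  rw [Set.mem_ofPred_eq, hB.proj_monomial_smul] at ha
  have : t - a.degree ∈ S := by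
    by_contra H
    rw [hS _ H, smul_zero, map_zero] at ha
    exact ha rfl
  refine Set.mem_biUnion this ?_
  simp

/-- Inverse polynomials are coinduced: a linear map `β` from a graded module to `V` determines the
linear map whose coefficient at `a` is `x ↦ β ((xᵃ x)_t)`. -/
noncomputable def coind : B →ₗ[MvPolynomial (Fin n) k] InversePolynomial n V :=
  let F : B →+ InversePolynomial n V :=
    { toFun := fun x => Finsupp.ofSupportFinite
        (fun a => β (hB.proj t ((monomial a (1 : k)) • x)))
        (finite_proj_monomial_smul_ne_zero hB β t x)
      map_zero' := ext fun a => by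
        change β (hB.proj t ((monomial a (1 : k)) • 0)) = 0
        rw [smul_zero, map_zero, map_zero]
      map_add' := fun x y => ext fun a => by
        change β (hB.proj t ((monomial a (1 : k)) • (x + y))) =
          β (hB.proj t ((monomial a (1 : k)) • x)) + β (hB.proj t ((monomial a (1 : k)) • y))
        rw [smul_add, map_add, map_add] }
  { F with
    map_smul' := map_smul_of_map_monomial_smul F fun b c x => ext fun a => by
      rw [coeff_monomial_smul]
      change β (hB.proj t ((monomial a (1 : k)) • (monomial b c) • x)) =
        c • β (hB.proj t ((monomial (a + b) (1 : k)) • x))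
      rw [← hβ, ← mul_smul, monomial_mul, one_mul, hB.proj_monomial_smul, hB.proj_monomial_smul,
        ← mul_smul, C_mul_monomial, mul_one] }

theorem coeff_coind (a : Fin n →₀ ℕ) (x : B) :
    coeff a (coind hB β hβ t x) = β (hB.proj t ((monomial a (1 : k)) • x)) := rfl

theorem coind_mem {d : ℤ} {x : B} (hx : x ∈ ℬ d) :
    coind hB β hβ t x ∈ grading n V (d - t) := by
  intro a ha
  rw [coeff_coind, hB.proj_ne (hB.monomial_smul_mem a 1 hx), map_zero]
  omega

theorem coind_degreePreserving : IsDegreePreserving ℬ (grading n V) (coind hB β hβ 0) :=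
  fun d x hx => by simpa using coind_mem hB β hβ 0 hx

end InversePolynomial

end InversePolynomials

/-! ### Inverse polynomials as the `*`injective hull of the residue field -/

section StarHull

open MvPolynomial

variable {k : Type u} [Field k] {n : ℕ}

namespace InversePolynomial

/-- The structure of a `k`-module that is inherited from the polynomial ring. -/
noncomputable abbrev constModule (k : Type u) [Field k] (n : ℕ) (A : Type v) [AddCommGroup A]
    [Module (MvPolynomial (Fin n) k) A] : Module k A :=
  Module.compHom A (C : k →+* MvPolynomial (Fin n) k)

/-- Degree preserving maps to `k[x_1⁻¹, …, x_n⁻¹]` extend along injective degree preserving maps: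
such a map is determined by the functional `x ↦ g(x)(0)`, and this functional extends. -/
theorem exists_extension {A : Type v} {B : Type w} [AddCommGroup A]
    [Module (MvPolynomial (Fin n) k) A] [AddCommGroup B] [Module (MvPolynomial (Fin n) k) B]
    {𝒜 : ℤ → AddSubgroup A} {ℬ : ℤ → AddSubgroup B} (hA : IsGradedModule k n 𝒜)
    (hB : IsGradedModule k n ℬ) (f : A →ₗ[MvPolynomial (Fin n) k] B)
    (g : A →ₗ[MvPolynomial (Fin n) k] InversePolynomial n k) (hf : IsDegreePreserving 𝒜 ℬ f)
    (hinj : Function.Injective f) (hg : IsDegreePreserving 𝒜 (grading n k) g) :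
    ∃ h : B →ₗ[MvPolynomial (Fin n) k] InversePolynomial n k,
      IsDegreePreserving ℬ (grading n k) h ∧ h ∘ₗ f = g := by
  let : Module k A := constModule k n A
  let : Module k B := constModule k n B
  let f' : A →ₗ[k] B := { f with map_smul' := fun c x => f.map_smul (C c) x }
  obtain ⟨s, hs⟩ := f'.exists_leftInverse_of_injective (LinearMap.ker_eq_bot.mpr hinj)
  have hsf : ∀ x, s (f x) = x := fun x => LinearMap.congr_fun hs x
  let β : B →+ k := ((coeff 0).comp g.toAddMonoidHom).comp s.toAddMonoidHom
  have hβ : ∀ (c : k) (x : B), β ((C c : MvPolynomial (Fin n) k) • x) = c • β x := by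
    intro c x
    change coeff 0 (g (s (c • x))) = c • coeff 0 (g (s x))
    rw [s.map_smul]
    change coeff 0 (g ((C c : MvPolynomial (Fin n) k) • (s x))) = _
    rw [g.map_smul, C_apply, coeff_monomial_smul, add_zero]
  refine ⟨coind hB β hβ 0, coind_degreePreserving hB β hβ, LinearMap.ext fun x => ext fun a => ?_⟩
  rw [LinearMap.comp_apply, coeff_coind, ← f.map_smul, ← hA.map_proj hB hf]
  change coeff 0 (g (s (f _))) = _
  rw [hsf, hA.map_proj (isGradedModule k n k) hg]
  have h0 : ∀ y : InversePolynomial n k,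
      coeff 0 ((isGradedModule k n k).proj 0 y) = coeff 0 y := by
    intro y
    refine (isGradedModule k n k).induction y (fun d z hz => ?_) fun y z hy hz => by
      rw [map_add, map_add, map_add, hy, hz]
    rw [(isGradedModule k n k).proj_of_mem hz]
    split_ifs with hd
    · rfl
    · rw [map_zero, hz]
      simpa using hd
  rw [h0, g.map_smul, coeff_monomial_smul, zero_add, one_smul]

theorem isStarInjective (k : Type u) [Field k] (n : ℕ) :
    IsStarInjective k n (grading n k) :=
  fun _ _ _ _ _ _ _ _ hA hB f g hf hinj hg => exists_extension hA hB f g hf hinj hg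

/-- A polynomial acts on constants through its constant coefficient. -/
theorem smul_single_zero {V : Type v} [AddCommGroup V] [Module k V]
    (r : MvPolynomial (Fin n) k) (v : V) :
    r • (single 0 v : InversePolynomial n V) = single 0 (constantCoeff r • v) := by
  induction r using MvPolynomial.induction_on with
  | C c => rw [C_apply, monomial_smul_single, if_pos le_rfl, tsub_zero, ← C_apply, constantCoeff_C]
  | add p q hp hq => rw [add_smul, hp, hq, map_add, add_smul, map_add]
  | mul_X p i _ =>
    rw [mul_smul, X_smul_single_zero, smul_zero, map_mul, constantCoeff_X, mul_zero, zero_smul,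
      map_zero]

end InversePolynomial

theorem mem_irrelevantIdeal_iff {r : MvPolynomial (Fin n) k} :
    r ∈ irrelevantIdeal k n ↔ constantCoeff r = 0 := by
  constructor
  · intro hr
    have : irrelevantIdeal k n ≤
        RingHom.ker (constantCoeff : MvPolynomial (Fin n) k →+* k) := by
      rw [irrelevantIdeal, Ideal.span_le]
      rintro _ ⟨i, rfl⟩
      change constantCoeff (X i : MvPolynomial (Fin n) k) = 0
      rw [constantCoeff_X]
    exact this hr
  · intro hr
    have : r - C (constantCoeff r) ∈ irrelevantIdeal k n := by
      clear hr
      induction r using MvPolynomial.induction_on with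
      | C c => simp
      | add p q hp hq =>
        rw [map_add, map_add, add_sub_add_comm]
        exact add_mem hp hq
      | mul_X p i _ =>
        rw [map_mul, constantCoeff_X, mul_zero, C_0, sub_zero]
        exact Ideal.mul_mem_left _ _ (Ideal.subset_span ⟨i, rfl⟩)
    rwa [hr, C_0, sub_zero] at this

open InversePolynomial in
/-- The inverse polynomials are a `*`injective hull of the residue field. -/
theorem InversePolynomial.isStarE (k : Type u) [Field k] (n : ℕ) :
    IsStarE k n (grading n k) := by
  let φ : MvPolynomial (Fin n) k →ₗ[MvPolynomial (Fin n) k] InversePolynomial n k :=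
    LinearMap.toSpanSingleton _ _ (single 0 1)
  have hφ : ∀ r, φ r = single 0 (constantCoeff r) := fun r => by
    rw [LinearMap.toSpanSingleton_apply, smul_single_zero, smul_eq_mul, mul_one]
  have hker : irrelevantIdeal k n = LinearMap.ker φ := by
    ext r
    rw [mem_irrelevantIdeal_iff, LinearMap.mem_ker, hφ]
    refine ⟨fun h => by rw [h, map_zero], fun h => ?_⟩
    rw [← coeff_single_same (0 : Fin n →₀ ℕ) (constantCoeff r), h, map_zero]
  refine ⟨Submodule.liftQ _ φ hker.le, isGradedModule k n k, isStarInjective k n, ?_, ?_, ?_⟩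
  · intro d x hx
    refine (AddSubgroup.closure_le ((grading n k d).comap
      (Submodule.liftQ _ φ hker.le).toAddMonoidHom)).mpr ?_ hx
    rintro _ ⟨i, r, hr, rfl, rfl⟩
    change φ r ∈ grading n k i
    intro a ha
    rw [hφ, coeff_single]
    split_ifs with h0
    · subst h0
      rw [constantCoeff_eq]
      refine (mem_homogeneousSubmodule i r |>.mp hr).coeff_eq_zero ?_
      intro h
      exact ha (by rw [← h]; simp)
    · rfl
  · rw [← LinearMap.ker_eq_bot]
    exact Submodule.ker_liftQ_eq_bot _ _ _ hker.ge
  · intro U _ hU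
    obtain ⟨c, hc, hcU⟩ := exists_single_zero_mem hU
    refine (Submodule.ne_bot_iff _).mpr ⟨single 0 c, ⟨hcU, ?_⟩, fun h => hc ?_⟩
    · refine ⟨Submodule.Quotient.mk (C c), ?_⟩
      rw [Submodule.liftQ_apply, hφ, constantCoeff_C]
    · rw [← coeff_single_same (0 : Fin n →₀ ℕ) c, h, map_zero]

open InversePolynomial in
/-- Every `*`injective hull of the residue field is isomorphic to the inverse polynomials. The
coinduced map of a functional that is nonzero on the residue field is injective by essentiality,
and a retraction of it, which exists as `E` is `*`injective, is injective because every nonzero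
submodule of the inverse polynomials contains the constants. -/
theorem IsStarE.exists_equiv {E : Type w} [AddCommGroup E] [Module (MvPolynomial (Fin n) k) E]
    {ℰ : ℤ → AddSubgroup E} (hE : IsStarE k n ℰ) :
    ∃ ρ : E ≃ₗ[MvPolynomial (Fin n) k] InversePolynomial n k,
      ∀ d x, x ∈ ℰ d ↔ ρ x ∈ grading n k d := by
  obtain ⟨j, hj⟩ := hE
  have hG := hj.isGradedModule
  have hD := isGradedModule k n k
  have hX1 : ∀ i, (X i : MvPolynomial (Fin n) k) • j 1 = 0 := by
    intro i
    rw [← j.map_smul, ← map_zero j]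
    congr 1
    refine Ideal.Quotient.eq_zero_iff_mem.mpr (?_ : X i * 1 ∈ irrelevantIdeal k n)
    rw [mem_irrelevantIdeal_iff, mul_one, constantCoeff_X]
  have hC : ∀ y : MvPolynomial (Fin n) k ⧸ irrelevantIdeal k n,
      ∃ c : k, j y = (C c : MvPolynomial (Fin n) k) • j 1 := by
    intro y
    obtain ⟨r, rfl⟩ := Ideal.Quotient.mk_surjective y
    refine ⟨constantCoeff r, ?_⟩
    rw [← j.map_smul]
    congr 1
    refine Ideal.Quotient.eq.mpr (?_ : r - C (constantCoeff r) * 1 ∈ irrelevantIdeal k n)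
    rw [mem_irrelevantIdeal_iff, mul_one, map_sub, constantCoeff_C, sub_self]
  have hj1 : j 1 ≠ 0 := by
    intro h0
    have h1 : (1 : MvPolynomial (Fin n) k ⧸ irrelevantIdeal k n) = 0 :=
      hj.injective (h0.trans (map_zero j).symm)
    have := (Ideal.Quotient.eq_zero_iff_mem (I := irrelevantIdeal k n) (a := 1)).mp h1
    rw [mem_irrelevantIdeal_iff, map_one] at this
    exact one_ne_zero this
  have hj1mem : j 1 ∈ ℰ 0 := by
    refine hj.degreePreserving 0 1 (AddSubgroup.subset_closure ⟨0, 1, ?_, rfl, rfl⟩)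
    exact isHomogeneous_one _ _
  let : Module k E := constModule k n E
  obtain ⟨β₀, hβ₀⟩ : ∃ β₀ : E →ₗ[k] k, β₀ (j 1) = 1 := by
    obtain ⟨g, hg⟩ := LinearMap.exists_leftInverse_of_injective
      (LinearMap.toSpanSingleton k E (j 1)) (LinearMap.ker_toSpanSingleton k hj1)
    refine ⟨g, ?_⟩
    simpa using LinearMap.congr_fun hg 1
  let ρ := coind hG β₀.toAddMonoidHom (fun c x => β₀.map_smul c x) 0
  have hρ : IsDegreePreserving ℰ (grading n k) ρ := coind_degreePreserving hG _ _
  have hρ1 : ρ (j 1) = single 0 1 := by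
    rw [eq_single_zero_of_X_smul_eq_zero (k := k) (f := ρ (j 1)) fun i => by
      rw [← ρ.map_smul, hX1, map_zero]]
    congr 1
    refine (coeff_coind hG _ _ 0 0 (j 1)).trans ?_
    rw [← C_apply, C_1, one_smul, hG.proj_same hj1mem]
    exact hβ₀
  have hsingle : ∀ c : k, c ≠ 0 → (single 0 c : InversePolynomial n k) ≠ 0 := by
    intro c hc h
    rw [← coeff_single_same (0 : Fin n →₀ ℕ) c, h, map_zero] at hc
    exact hc rfl
  have hinj : Function.Injective ρ := by
    rw [← LinearMap.ker_eq_bot]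
    by_contra hne
    obtain ⟨x, ⟨hx, y, rfl⟩, hx0⟩ := (Submodule.ne_bot_iff _).mp
      (hj.essential _ (hG.isGradedSubmodule_ker hD hρ) hne)
    obtain ⟨c, hc⟩ := hC y
    rw [hc] at hx hx0
    have hc0 : c ≠ 0 := by
      rintro rfl
      exact hx0 (by rw [C_0, zero_smul])
    have : ρ ((C c : MvPolynomial (Fin n) k) • j 1) = 0 := hx
    rw [ρ.map_smul, hρ1, smul_single_zero, constantCoeff_C, smul_eq_mul, mul_one] at this
    exact hsingle c hc0 this
  -- `*`injectivity is tested in a common universe of `k` and `E`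
  let eE : ULift.{u} E ≃ₗ[MvPolynomial (Fin n) k] E := ULift.moduleEquiv
  let eD : ULift.{w} (InversePolynomial n k) ≃ₗ[MvPolynomial (Fin n) k] InversePolynomial n k :=
    ULift.moduleEquiv
  obtain ⟨h, -, hh⟩ := hj.starInjective _ _ _ _ (hG.comap_equiv eE) (hD.comap_equiv eD)
    (eD.symm.toLinearMap ∘ₗ ρ ∘ₗ eE.toLinearMap) eE.toLinearMap
    (fun d x hx => hρ d _ hx) (eD.symm.injective.comp (hinj.comp eE.injective)) (fun d x hx => hx)
  have hret : ∀ x, h (eD.symm (ρ x)) = x := fun x => LinearMap.congr_fun hh (eE.symm x)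
  have hker : LinearMap.ker (h ∘ₗ eD.symm.toLinearMap) = ⊥ := by
    by_contra hne
    obtain ⟨c, hc, hmem⟩ := exists_single_zero_mem hne
    have h1 : (single 0 c : InversePolynomial n k) = ρ ((C c : MvPolynomial (Fin n) k) • j 1) := by
      rw [ρ.map_smul, hρ1, smul_single_zero, constantCoeff_C, smul_eq_mul, mul_one]
    have h2 : h (eD.symm (single 0 c)) = 0 := hmem
    have h3 := hsingle c hc
    rw [h1, hret] at h2
    rw [h1, h2, map_zero] at h3
    exact h3 rfl
  have hsurj : Function.Surjective ρ := fun y =>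
    ⟨h (eD.symm y), LinearMap.ker_eq_bot.mp hker (hret (h (eD.symm y)))⟩
  exact ⟨LinearEquiv.ofBijective ρ ⟨hinj, hsurj⟩,
    fun d x => hG.mem_iff_of_injective hD hρ hinj d x⟩

end StarHull

/-! ### Coordinates on the Frobenius pullback -/

section FrobeniusCoordinates

open MvPolynomial

namespace FrobeniusPullback

variable {R : Type u} [CommRing R] {p : ℕ} [ExpChar R p] {M : Type v} [AddCommGroup M] [Module R M]

theorem tmul_add (r : R) (x y : M) : tmul p r (x + y) = tmul p r x + tmul p r y :=
  TensorProduct.tmul_add _ _ _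

theorem add_tmul (r s : R) (x : M) : tmul p (r + s) x = tmul p r x + tmul p s x :=
  TensorProduct.add_tmul _ _ _

theorem tmul_zero (r : R) : tmul p r (0 : M) = 0 := TensorProduct.tmul_zero _ _

theorem tmul_smul (r s : R) (x : M) : tmul p r (s • x) = tmul p (s ^ p * r) x :=
  (TensorProduct.smul_tmul s (FrobeniusTarget.of R p r) x).symm

theorem smul_tmul (r s : R) (x : M) : s • tmul p r x = tmul p (s * r) x := rfl

@[elab_as_elim]
theorem induction {P : FrobeniusPullback R p M → Prop} (z : FrobeniusPullback R p M)
    (tmul : ∀ r x, P (tmul p r x)) (add : ∀ y z, P y → P z → P (y + z)) : P z :=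
  have h0 : P 0 := tmul_zero (p := p) (M := M) (0 : R) ▸ tmul 0 0
  TensorProduct.induction_on z h0 tmul add

/-- The additive map `F(M) → M`, `r ⊗ x ↦ L(r) x`, of a Frobenius-inverse linear map `L : R → R`. -/
noncomputable def contract (L : R →+ R) (hL : ∀ s r, L (s ^ p * r) = s * L r) :
    FrobeniusPullback R p M →+ M :=
  let L' : FrobeniusTarget R p →ₗ[R] R := { L with map_smul' := hL }
  ((TensorProduct.lid R M).toLinearMap ∘ₗ L'.rTensor M).toAddMonoidHom

end FrobeniusPullback

/-- The dual basis of a field over its subfield of `p`-th powers. -/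
theorem exists_frobenius_dual_basis (k : Type u) [Field k] (p : ℕ) [ExpChar k p] :
    ∃ (I : Type u) (b : I → k) (l : I → k →+ k), (∀ i s x, l i (s ^ p * x) = s * l i x) ∧
      ∀ x, ∃ S : Finset I, ∀ T, S ⊆ T → x = ∑ i ∈ T, l i x ^ p * b i := by
  let B := Module.Basis.ofVectorSpace k (FrobeniusTarget k p)
  refine ⟨_, fun i => B i, fun i => (B.coord i).toAddMonoidHom,
    fun i s x => (B.coord i).map_smul s x, fun x => ⟨(B.repr x).support, fun T hT => ?_⟩⟩
  refine (B.linearCombination_repr x).symm.trans ?_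
  exact Finsupp.sum_of_support_subset _ hT _ fun i _ => zero_smul k (B i)

namespace Finsupp

variable {σ : Type*}

/-- The quotients of the exponents by `p`. -/
noncomputable def quot (p : ℕ) (b : σ →₀ ℕ) : σ →₀ ℕ := b.mapRange (· / p) (Nat.zero_div p)

/-- The remainders of the exponents modulo `p`. -/
noncomputable def rem (p : ℕ) (b : σ →₀ ℕ) : σ →₀ ℕ := b.mapRange (· % p) (Nat.zero_mod p)

variable {p : ℕ}

theorem quot_apply (b : σ →₀ ℕ) (i : σ) : quot p b i = b i / p := rfl

theorem rem_apply (b : σ →₀ ℕ) (i : σ) : rem p b i = b i % p := rfl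

theorem nsmul_quot_add_rem (p : ℕ) (b : σ →₀ ℕ) : p • quot p b + rem p b = b :=
  Finsupp.ext fun i => Nat.div_add_mod (b i) p

theorem rem_nsmul_add (e b : σ →₀ ℕ) : rem p (p • e + b) = rem p b :=
  Finsupp.ext fun i => by
    simp [rem_apply]

theorem quot_nsmul_add (hp : 0 < p) (e b : σ →₀ ℕ) : quot p (p • e + b) = e + quot p b :=
  Finsupp.ext fun i => by
    simp [quot_apply, Nat.mul_add_div hp]

end Finsupp

section

variable {k : Type u} [Field k] {n p : ℕ}

/-- The coordinate of a polynomial at the exponent `a` with respect to the subring of `p`-th powers,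
where a Frobenius-inverse linear map `l` is applied to the coefficients: the monomial `c xᵇ` is sent
to `l(c) x^q` if `b = p q + a`, and to zero if `a` is not the remainder of `b`. -/
noncomputable def frobeniusCoord (p : ℕ) (l : k →+ k) (a : Fin n →₀ ℕ) :
    MvPolynomial (Fin n) k →+ MvPolynomial (Fin n) k := by
  classical
  exact AddMonoidAlgebra.liftNC (C.toAddMonoidHom.comp l)
    fun b => if Finsupp.rem p b.toAdd = a then monomial (Finsupp.quot p b.toAdd) 1 else 0

open Classical in
theorem frobeniusCoord_monomial (l : k →+ k) (a b : Fin n →₀ ℕ) (c : k) :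
    frobeniusCoord p l a (monomial b c) =
      if Finsupp.rem p b = a then monomial (Finsupp.quot p b) (l c) else 0 := by
  refine (AddMonoidAlgebra.liftNC_single _ _ _ _).trans ?_
  change C (l c) * (if Finsupp.rem p b = a then monomial (Finsupp.quot p b) 1 else 0) = _
  split_ifs
  · rw [C_mul_monomial, mul_one]
  · rw [mul_zero]

theorem frobeniusCoord_pow_mul [ExpChar (MvPolynomial (Fin n) k) p] {l : k →+ k}
    (hl : ∀ s x, l (s ^ p * x) = s * l x) (a : Fin n →₀ ℕ) (s r : MvPolynomial (Fin n) k) :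
    frobeniusCoord p l a (s ^ p * r) = s * frobeniusCoord p l a r := by
  have hp : 0 < p := expChar_pos (MvPolynomial (Fin n) k) p
  induction s using MvPolynomial.induction_on' with
  | add s s' hs hs' => rw [add_pow_expChar, add_mul, map_add, hs, hs', add_mul]
  | monomial e d =>
    induction r using MvPolynomial.induction_on' with
    | add r r' hr hr' => rw [mul_add, map_add, hr, hr', map_add, mul_add]
    | monomial b c =>
      rw [monomial_pow, monomial_mul, frobeniusCoord_monomial, frobeniusCoord_monomial,
        Finsupp.rem_nsmul_add, Finsupp.quot_nsmul_add hp, hl]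
      split_ifs
      · rw [monomial_mul]
      · rw [mul_zero]

/-- Multiplication by `xᵉ` moves the coordinate at `a` to the remainder of `e + a`, and multiplies it
by the monomial of the quotient of `e + a`. -/
theorem frobeniusCoord_monomial_mul (hp : 0 < p) (l : k →+ k) {a : Fin n →₀ ℕ}
    (ha : ∀ i, a i < p) (e : Fin n →₀ ℕ) (r : MvPolynomial (Fin n) k) :
    frobeniusCoord p l (Finsupp.rem p (e + a)) (monomial e 1 * r) =
      monomial (Finsupp.quot p (e + a)) 1 * frobeniusCoord p l a r := by
  induction r using MvPolynomial.induction_on' with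
  | add r r' hr hr' => rw [mul_add, map_add, hr, hr', map_add, mul_add]
  | monomial b c =>
    rw [monomial_mul, one_mul, frobeniusCoord_monomial, frobeniusCoord_monomial]
    have hiff : Finsupp.rem p (e + b) = Finsupp.rem p (e + a) ↔ Finsupp.rem p b = a := by
      rw [Finsupp.ext_iff, Finsupp.ext_iff]
      refine forall_congr' fun i => ?_
      rw [Finsupp.rem_apply, Finsupp.rem_apply, Finsupp.rem_apply, Finsupp.add_apply,
        Finsupp.add_apply]
      refine ⟨fun h => ?_, fun h => ?_⟩
      · have : b i ≡ a i [MOD p] := Nat.ModEq.add_left_cancel' (e i) h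
        rwa [Nat.ModEq, Nat.mod_eq_of_lt (ha i)] at this
      · have : b i ≡ a i [MOD p] := by rw [Nat.ModEq, h, Nat.mod_eq_of_lt (ha i)]
        exact this.add_left (e i)
    by_cases h : Finsupp.rem p b = a
    · rw [if_pos (hiff.mpr h), if_pos h, monomial_mul, one_mul]
      congr 2
      conv_lhs => rw [← Finsupp.nsmul_quot_add_rem p b, h]
      rw [add_left_comm, Finsupp.quot_nsmul_add hp, add_comm]
    · rw [if_neg (mt hiff.mp h), if_neg h, mul_zero]

end

namespace FrobeniusPullback

variable {k : Type u} [Field k] {n p : ℕ} [ExpChar (MvPolynomial (Fin n) k) p] {M : Type v}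
  [AddCommGroup M] [Module (MvPolynomial (Fin n) k) M]

/-- The coordinate of an element of `F(M)` at the exponent `a`: the map
`r ⊗ x ↦ frobeniusCoord p l a r • x`. -/
noncomputable def coord {l : k →+ k} (hl : ∀ s x, l (s ^ p * x) = s * l x) (a : Fin n →₀ ℕ) :
    FrobeniusPullback (MvPolynomial (Fin n) k) p M →+ M :=
  contract (frobeniusCoord p l a) (frobeniusCoord_pow_mul hl a)

variable {l : k →+ k} (hl : ∀ s x, l (s ^ p * x) = s * l x)

theorem coord_tmul (a : Fin n →₀ ℕ) (r : MvPolynomial (Fin n) k) (x : M) :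
    coord hl a (tmul p r x) = frobeniusCoord p l a r • x := rfl

theorem coord_monomial_smul {a : Fin n →₀ ℕ} (ha : ∀ i, a i < p) (e : Fin n →₀ ℕ)
    (z : FrobeniusPullback (MvPolynomial (Fin n) k) p M) :
    coord hl (Finsupp.rem p (e + a)) ((monomial e (1 : k)) • z) =
      (monomial (Finsupp.quot p (e + a)) (1 : k)) • coord hl a z := by
  refine induction z (fun r x => ?_) fun y z hy hz => by
    rw [smul_add, map_add, map_add, hy, hz, smul_add]
  rw [smul_tmul, coord_tmul, coord_tmul,
    frobeniusCoord_monomial_mul (expChar_pos (MvPolynomial (Fin n) k) p) l ha, mul_smul]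

/-- The largest remainder `(p - 1, …, p - 1)`. -/
noncomputable def topRem (n p : ℕ) : Fin n →₀ ℕ := Finsupp.equivFunOnFinite.symm fun _ => p - 1

theorem topRem_apply (i : Fin n) : topRem n p i = p - 1 := rfl

theorem degree_topRem : (topRem n p).degree = n * (p - 1) := by
  simp [Finsupp.degree_eq_sum, topRem_apply]

omit [ExpChar (MvPolynomial (Fin n) k) p] in
theorem lt_of_le_topRem (hp : 0 < p) {a : Fin n →₀ ℕ} (ha : a ≤ topRem n p) (i : Fin n) :
    a i < p := by
  have := ha i
  rw [topRem_apply] at this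
  omega

variable {z : FrobeniusPullback (MvPolynomial (Fin n) k) p M}
  (hz : ∀ i, (X i : MvPolynomial (Fin n) k) • z = 0)

include hz

/-- If `a i < p - 1`, then multiplication by `x_i` only moves the coordinate at `a`, so that this
coordinate vanishes as soon as `x_i` annihilates the element. -/
theorem coord_eq_zero {a : Fin n →₀ ℕ} (ha : ∀ i, a i < p) (hne : a ≠ topRem n p) :
    coord hl a z = 0 := by
  obtain ⟨i, hi⟩ : ∃ i, a i ≠ p - 1 := by
    by_contra! H
    exact hne (Finsupp.ext H)
  have h := coord_monomial_smul hl ha (Finsupp.single i 1) z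
  have h0 : Finsupp.quot p (Finsupp.single i 1 + a) = 0 := by
    ext j
    rw [Finsupp.quot_apply, Finsupp.add_apply, Finsupp.zero_apply]
    refine Nat.div_eq_of_lt ?_
    have := ha j
    by_cases hij : i = j
    · subst hij
      rw [Finsupp.single_eq_same]
      omega
    · rw [Finsupp.single_eq_of_ne (Ne.symm hij)]
      omega
  rw [h0, ← C_apply, C_1, one_smul] at h
  rw [← h, ← X, hz, map_zero]

/-- Multiplication by `x_i` wraps the exponent `p - 1` around to `0`, and multiplies the coordinate
by `x_i`. -/
theorem X_smul_coord_topRem (i : Fin n) :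
    (X i : MvPolynomial (Fin n) k) • coord hl (topRem n p) z = 0 := by
  have hp : 0 < p := expChar_pos (MvPolynomial (Fin n) k) p
  have h := coord_monomial_smul hl (lt_of_le_topRem hp le_rfl) (Finsupp.single i 1) z
  have h0 : Finsupp.quot p (Finsupp.single i 1 + topRem n p) = Finsupp.single i 1 := by
    ext j
    rw [Finsupp.quot_apply, Finsupp.add_apply, topRem_apply]
    by_cases hij : i = j
    · subst hij
      rw [Finsupp.single_eq_same, show 1 + (p - 1) = p by omega, Nat.div_self hp]
    · rw [Finsupp.single_eq_of_ne (Ne.symm hij), zero_add]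
      exact Nat.div_eq_of_lt (by omega)
  rw [h0, ← X, hz, map_zero] at h
  exact h.symm

omit hz

/-- Elements of `F(M)` are recovered from their coordinates. -/
theorem exists_sum_coord {I : Type u} {b : I → k} {l : I → k →+ k}
    (hl : ∀ i s x, l i (s ^ p * x) = s * l i x)
    (hb : ∀ x, ∃ S : Finset I, ∀ T, S ⊆ T → x = ∑ i ∈ T, l i x ^ p * b i)
    (z : FrobeniusPullback (MvPolynomial (Fin n) k) p M) :
    ∃ S : Finset I, z = ∑ i ∈ S, ∑ a ∈ Finset.Icc 0 (topRem n p),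
      tmul p (monomial a (b i)) (coord (hl i) a z) := by
  classical
  have hp : 0 < p := expChar_pos (MvPolynomial (Fin n) k) p
  suffices H : ∃ S : Finset I, ∀ T, S ⊆ T → z = ∑ i ∈ T, ∑ a ∈ Finset.Icc 0 (topRem n p),
      tmul p (monomial a (b i)) (coord (hl i) a z) by
    obtain ⟨S, hS⟩ := H
    exact ⟨S, hS S subset_rfl⟩
  have hadd : ∀ y z : FrobeniusPullback (MvPolynomial (Fin n) k) p M,
      (∃ S : Finset I, ∀ T, S ⊆ T → y = ∑ i ∈ T, ∑ a ∈ Finset.Icc 0 (topRem n p),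
        tmul p (monomial a (b i)) (coord (hl i) a y)) →
      (∃ S : Finset I, ∀ T, S ⊆ T → z = ∑ i ∈ T, ∑ a ∈ Finset.Icc 0 (topRem n p),
        tmul p (monomial a (b i)) (coord (hl i) a z)) →
      (∃ S : Finset I, ∀ T, S ⊆ T → y + z = ∑ i ∈ T, ∑ a ∈ Finset.Icc 0 (topRem n p),
        tmul p (monomial a (b i)) (coord (hl i) a (y + z))) := by
    rintro y z ⟨S, hS⟩ ⟨S', hS'⟩
    refine ⟨S ∪ S', fun T hT => ?_⟩
    simp only [map_add, tmul_add, Finset.sum_add_distrib]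
    rw [← hS T (Finset.union_subset_left hT), ← hS' T (Finset.union_subset_right hT)]
  refine induction z (fun r x => ?_) hadd
  induction r using MvPolynomial.induction_on' with
  | add r s hr hs =>
    rw [add_tmul]
    exact hadd _ _ hr hs
  | monomial e c =>
    obtain ⟨S, hS⟩ := hb c
    refine ⟨S, fun T hT => ?_⟩
    have hmem : Finsupp.rem p e ∈ Finset.Icc 0 (topRem n p) := by
      rw [Finset.mem_Icc]
      refine ⟨zero_le, fun i => ?_⟩
      have : e i % p < p := Nat.mod_lt _ hp
      rw [Finsupp.rem_apply, topRem_apply]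
      omega
    have hterm : ∀ i, ∑ a ∈ Finset.Icc 0 (topRem n p),
        tmul p (monomial a (b i)) (coord (hl i) a (tmul p (monomial e c) x)) =
          tmul p (monomial e (l i c ^ p * b i)) x := by
      intro i
      rw [Finset.sum_eq_single_of_mem _ hmem]
      · rw [coord_tmul, frobeniusCoord_monomial, if_pos rfl, tmul_smul, monomial_pow, monomial_mul,
          Finsupp.nsmul_quot_add_rem]
      · intro a _ ha
        rw [coord_tmul, frobeniusCoord_monomial, if_neg (Ne.symm ha), zero_smul, tmul_zero]
    simp only [hterm]
    conv_lhs => rw [hS T hT]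
    rw [map_sum]
    exact map_sum (AddMonoidHom.mk' (fun r => tmul p r x) fun r s => add_tmul r s x) _ _

/-- Elements of `F(M)` that are annihilated by all variables only involve tensors with
`x^(p-1, …, p-1)`. -/
theorem exists_sum_coord_topRem {I : Type u} {b : I → k} {l : I → k →+ k}
    (hl : ∀ i s x, l i (s ^ p * x) = s * l i x)
    (hb : ∀ x, ∃ S : Finset I, ∀ T, S ⊆ T → x = ∑ i ∈ T, l i x ^ p * b i)
    (hz : ∀ i, (X i : MvPolynomial (Fin n) k) • z = 0) :
    ∃ S : Finset I, z = ∑ i ∈ S,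
      tmul p (monomial (topRem n p) (b i)) (coord (hl i) (topRem n p) z) := by
  have hp : 0 < p := expChar_pos (MvPolynomial (Fin n) k) p
  obtain ⟨S, hS⟩ := exists_sum_coord hl hb z
  refine ⟨S, hS.trans (Finset.sum_congr rfl fun i _ => ?_)⟩
  refine Finset.sum_eq_single_of_mem _ (Finset.mem_Icc.mpr ⟨zero_le, le_rfl⟩) fun a ha hne => ?_
  rw [coord_eq_zero (hl i) hz (lt_of_le_topRem hp (Finset.mem_Icc.mp ha).2) hne, tmul_zero]

variable {ℳ : ℤ → AddSubgroup M}

theorem coord_tmul_of_mem (hM : IsGradedModule k n ℳ) (a : Fin n →₀ ℕ) {d j : ℤ} {i : ℕ}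
    {r : MvPolynomial (Fin n) k} {x : M} (hr : r ∈ homogeneousSubmodule (Fin n) k i) (hx : x ∈ ℳ j)
    (hd : i + p * j = d) (Q : AddSubgroup M)
    (hQ : ∀ e, d = a.degree + p * e → ℳ e ≤ Q) : coord hl a (tmul p r x) ∈ Q := by
  rw [coord_tmul, r.as_sum, map_sum, Finset.sum_smul]
  refine sum_mem fun b hb => ?_
  have hi : b.degree = i := by
    rw [mem_homogeneousSubmodule] at hr
    by_contra H
    exact (MvPolynomial.mem_support_iff.mp hb) (hr.coeff_eq_zero H)
  rw [frobeniusCoord_monomial]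
  split_ifs with h
  · refine hQ _ ?_ (hM.monomial_smul_mem _ _ hx)
    have h1 := congrArg Finsupp.degree (Finsupp.nsmul_quot_add_rem p b)
    rw [map_add, map_nsmul, h, hi, smul_eq_mul] at h1
    rw [← hd, ← h1]
    push_cast
    ring
  · rw [zero_smul]
    exact zero_mem _

/-- The coordinate at `a` of an element of degree `d` lies in degree `(d - |a|) / p`. Membership in a
test subgroup `Q` also covers the case where `p` does not divide `d - |a|` and the coordinate is
zero. -/
theorem coord_mem_of_forall (hM : IsGradedModule k n ℳ) (a : Fin n →₀ ℕ) {d : ℤ}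
    (hz : z ∈ frobeniusGrading p ℳ d) (Q : AddSubgroup M)
    (hQ : ∀ e, d = a.degree + p * e → ℳ e ≤ Q) : coord hl a z ∈ Q := by
  refine (AddSubgroup.closure_le (Q.comap (coord hl a))).mpr ?_ hz
  rintro _ ⟨i, j, r, x, hr, hx, hd, rfl⟩
  exact coord_tmul_of_mem hl hM a hr hx hd Q hQ

/-- The coordinates of a homogeneous element of `F(M)` are homogeneous. -/
theorem coord_mem (hM : IsGradedModule k n ℳ) (a : Fin n →₀ ℕ) {d e : ℤ}
    (hz : z ∈ frobeniusGrading p ℳ d) (hd : d = a.degree + p * e) : coord hl a z ∈ ℳ e := by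
  have hp : 0 < p := expChar_pos (MvPolynomial (Fin n) k) p
  refine coord_mem_of_forall hl hM a hz (ℳ e) fun e' he' => ?_
  have : (p : ℤ) * e = p * e' := by linarith
  rw [mul_left_cancel₀ (by positivity) this]

theorem exists_degree_of_coord_ne_zero (hM : IsGradedModule k n ℳ) (a : Fin n →₀ ℕ) {d : ℤ}
    (hz : z ∈ frobeniusGrading p ℳ d) (h0 : coord hl a z ≠ 0) :
    ∃ e : ℤ, d = a.degree + p * e := by
  by_contra! H
  exact h0 (coord_mem_of_forall hl hM a hz ⊥ fun e he => absurd he (H e))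

end FrobeniusPullback

end FrobeniusCoordinates

/-! ### The socle of a graded `F`-module -/

section Socle

open MvPolynomial

variable {k : Type u} [Field k] {n : ℕ} {M : Type v} [AddCommGroup M]
  [Module (MvPolynomial (Fin n) k) M]

/-- On a module supported on `𝔪` the radical of each annihilator contains `𝔪`. -/
theorem X_pow_smul_eq_zero_of_support
    (hsupp : ∀ P ∈ Module.support (MvPolynomial (Fin n) k) M, P.asIdeal = irrelevantIdeal k n)
    (i : Fin n) (x : M) : ∃ N : ℕ, (X i : MvPolynomial (Fin n) k) ^ N • x = 0 := by
  have h : (X i : MvPolynomial (Fin n) k) ∈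
      (Submodule.span (MvPolynomial (Fin n) k) {x}).annihilator.radical := by
    rw [Ideal.radical_eq_sInf, Ideal.mem_sInf]
    rintro P ⟨hP, hprime⟩
    have : (⟨P, hprime⟩ : PrimeSpectrum (MvPolynomial (Fin n) k)) ∈
        Module.support (MvPolynomial (Fin n) k) M :=
      Module.mem_support_iff_exists_annihilator.mpr ⟨x, hP⟩
    have hPm : P = irrelevantIdeal k n := hsupp _ this
    rw [hPm]
    exact Ideal.subset_span ⟨i, rfl⟩
  obtain ⟨N, hN⟩ := h
  exact ⟨N, Submodule.mem_annihilator_span_singleton x _ |>.mp hN⟩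

theorem monomial_smul_eq_zero_of_X_smul_eq_zero {x : M}
    (hx : ∀ i, (X i : MvPolynomial (Fin n) k) • x = 0) {a : Fin n →₀ ℕ} (ha : a ≠ 0) (c : k) :
    (monomial a c : MvPolynomial (Fin n) k) • x = 0 := by
  obtain ⟨i, hi⟩ : ∃ i, a i ≠ 0 := by
    by_contra! H
    exact ha (Finsupp.ext H)
  have h1 : a = (a - Finsupp.single i 1) + Finsupp.single i 1 :=
    (tsub_add_cancel_of_le (by rw [Finsupp.single_le_iff]; omega)).symm
  rw [h1, ← mul_one c, ← monomial_mul, mul_smul, ← X, hx, smul_zero]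

theorem IsGradedModule.X_smul_proj_eq_zero {ℳ : ℤ → AddSubgroup M} (hM : IsGradedModule k n ℳ)
    {x : M} (hx : ∀ i, (X i : MvPolynomial (Fin n) k) • x = 0) (d : ℤ) (i : Fin n) :
    (X i : MvPolynomial (Fin n) k) • hM.proj d x = 0 := by
  rw [← hM.proj_smul (e := (1 : ℕ) + d) (isHomogeneous_X k i) rfl, hx, map_zero]

/-- An element `m` lifts `v` through the monomial `xᵇ` if `xᵇ m = v` and all other monomials of
degree at least `|b|` annihilate `m`. -/
def IsMonomialLift (k : Type u) [Field k] {n : ℕ} {M : Type v} [AddCommGroup M]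
    [Module (MvPolynomial (Fin n) k) M] (b : Fin n →₀ ℕ) (v m : M) : Prop :=
  (monomial b (1 : k)) • m = v ∧
    ∀ a : Fin n →₀ ℕ, b.degree ≤ a.degree → a ≠ b → (monomial a (1 : k)) • m = 0

theorem IsMonomialLift.of_le {a b : Fin n →₀ ℕ} (hab : a ≤ b) {v m : M}
    (hm : IsMonomialLift k b v m) :
    IsMonomialLift k a v ((monomial (b - a) (1 : k)) • m) := by
  have hba : a + (b - a) = b := add_tsub_cancel_of_le hab
  refine ⟨?_, fun e he hne => ?_⟩
  · rw [← mul_smul, monomial_mul, one_mul, hba, hm.1]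
  · rw [← mul_smul, monomial_mul, one_mul]
    refine hm.2 _ ?_ fun h => hne ?_
    · rw [← hba, map_add, map_add, hba]
      omega
    · rw [← hba] at h
      simpa using h

variable {p : ℕ} [Fact p.Prime] [CharP k p] {ℳ : ℤ → AddSubgroup M}
  (hM : GradedFModuleStructure k n p ℳ)

include hM

open FrobeniusPullback

/-- The socle of a graded `F`-module lives in degree `-n`: passing to `F(M)` turns socle elements of
degree `j` into socle elements of degree `e` with `e + n = p (j + n)`. -/
theorem GradedFModuleStructure.degree_eq_of_X_smul_eq_zero {e : ℤ} {x : M} (hxe : x ∈ ℳ e)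
    (hx0 : x ≠ 0) (hx : ∀ i, (X i : MvPolynomial (Fin n) k) • x = 0) : e = -n := by
  induction hN : (e + n).natAbs using Nat.strong_induction_on generalizing e x with
  | _ N ih =>
  obtain ⟨I, b, l, hl, hb⟩ := exists_frobenius_dual_basis k p
  have hz : ∀ i, (X i : MvPolynomial (Fin n) k) • hM.θ x = 0 := fun i => by
    rw [← hM.θ.map_smul, hx, map_zero]
  have hzmem : hM.θ x ∈ frobeniusGrading p ℳ e := hM.degreePreserving e x hxe
  obtain ⟨S, hS⟩ := exists_sum_coord_topRem hl hb hz
  obtain ⟨i, hi⟩ : ∃ i, coord (hl i) (topRem n p) (hM.θ x) ≠ 0 := by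
    by_contra! H
    rw [Finset.sum_eq_zero fun i _ => by rw [H, tmul_zero]] at hS
    exact hx0 (hM.θ.map_eq_zero_iff.mp hS)
  obtain ⟨j, hj⟩ := exists_degree_of_coord_ne_zero (hl i) hM.isGradedModule _ hzmem hi
  have hjmem := coord_mem (hl i) hM.isGradedModule _ hzmem hj
  have hp : 2 ≤ p := (Fact.out : p.Prime).two_le
  have hej : e + n = p * (j + n) := by
    rw [hj, degree_topRem]
    push_cast [Nat.cast_sub (show 1 ≤ p by omega)]
    ring
  by_contra hne
  have hj0 : j + n ≠ 0 := fun h => hne (by rw [h, mul_zero] at hej; omega)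
  have hlt : (j + n).natAbs < N := by
    rw [← hN, hej, Int.natAbs_mul, Int.natAbs_natCast]
    have : 0 < (j + n).natAbs := Int.natAbs_pos.mpr hj0
    nlinarith
  exact hj0 (by rw [ih _ hlt hjmem hi (X_smul_coord_topRem (hl i) hz) rfl]; ring)

omit [CharP k p] hM in
theorem Finsupp.quot_topRem : Finsupp.quot p (topRem n p) = 0 :=
  Finsupp.ext fun i => Nat.div_eq_of_lt (lt_of_le_topRem (Fact.out : p.Prime).pos le_rfl i)

omit [CharP k p] hM in
theorem Finsupp.rem_topRem : Finsupp.rem p (topRem n p) = topRem n p :=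
  Finsupp.ext fun i => Nat.mod_eq_of_lt (lt_of_le_topRem (Fact.out : p.Prime).pos le_rfl i)

/-- If all socle elements lift through `xᵇ`, then they lift through `x^(p b + (p - 1, …, p - 1))`:
the tensors `c ⊗ m` with `m` a lift of `v` are lifts of `c x^(p-1, …, p-1) ⊗ v`, and these tensors
span the socle of `F(M)`. -/
theorem GradedFModuleStructure.exists_isMonomialLift_frobenius {b : Fin n →₀ ℕ}
    (hlift : ∀ v : M, (∀ i, (X i : MvPolynomial (Fin n) k) • v = 0) →
      ∃ m, IsMonomialLift k b v m) {v : M}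
    (hv : ∀ i, (X i : MvPolynomial (Fin n) k) • v = 0) :
    ∃ m, IsMonomialLift k (p • b + topRem n p) v m := by
  have hp : 0 < p := (Fact.out : p.Prime).pos
  obtain ⟨I, c, l, hl, hc⟩ := exists_frobenius_dual_basis k p
  have hz : ∀ i, (X i : MvPolynomial (Fin n) k) • hM.θ v = 0 := fun i => by
    rw [← hM.θ.map_smul, hv, map_zero]
  obtain ⟨S, hS⟩ := exists_sum_coord_topRem hl hc hz
  choose m hm using fun i => hlift _ (X_smul_coord_topRem (hl i) hz)
  have hsmul : ∀ a : Fin n →₀ ℕ, (monomial a (1 : k)) •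
      hM.θ.symm (∑ i ∈ S, tmul p (C (c i)) (m i)) = hM.θ.symm (∑ i ∈ S,
        tmul p (monomial (Finsupp.rem p a) (c i))
          ((monomial (Finsupp.quot p a) (1 : k)) • m i)) := by
    intro a
    rw [← hM.θ.symm.map_smul, Finset.smul_sum]
    refine congrArg _ (Finset.sum_congr rfl fun i _ => ?_)
    rw [smul_tmul, tmul_smul, monomial_pow, monomial_mul, Finsupp.nsmul_quot_add_rem, one_pow,
      one_mul, mul_comm, C_mul_monomial, mul_one]
  refine ⟨hM.θ.symm (∑ i ∈ S, tmul p (C (c i)) (m i)), ?_, fun a ha hne => ?_⟩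
  · rw [hsmul, Finsupp.quot_nsmul_add hp, Finsupp.rem_nsmul_add, Finsupp.quot_topRem, add_zero,
      Finsupp.rem_topRem, LinearEquiv.symm_apply_eq, hS]
    exact Finset.sum_congr rfl fun i _ => by rw [(hm i).1]
  · rw [hsmul, Finset.sum_eq_zero, map_zero]
    intro i _
    have hle : Finsupp.rem p a ≤ topRem n p := fun j => by
      have : a j % p < p := Nat.mod_lt _ hp
      rw [Finsupp.rem_apply, topRem_apply]
      omega
    have h1 := congrArg Finsupp.degree (Finsupp.nsmul_quot_add_rem p a)
    have h2 := congrArg Finsupp.degree (add_tsub_cancel_of_le hle)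
    rw [map_add, map_nsmul, smul_eq_mul] at h1
    rw [map_add] at h2
    rw [map_add, map_nsmul, smul_eq_mul] at ha
    -- the degree of the remainder is at most `|topRem n p|`, so the quotient has degree at least
    -- `|b|`; if it equals `b`, then the remainder is `topRem n p`, which is excluded
    rw [(hm i).2, tmul_zero]
    · by_contra! H
      have : p * ((Finsupp.quot p a).degree + 1) ≤ p * b.degree := Nat.mul_le_mul_left p H
      rw [mul_add] at this
      omega
    · intro hq
      rw [hq] at h1
      have h3 : (topRem n p - Finsupp.rem p a).degree = 0 := by omega
      rw [Finsupp.degree_eq_zero_iff] at h3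
      apply hne
      rw [← Finsupp.nsmul_quot_add_rem p a, hq, ← add_tsub_cancel_of_le hle, h3, add_zero]

theorem GradedFModuleStructure.exists_isMonomialLift (a : Fin n →₀ ℕ) {v : M}
    (hv : ∀ i, (X i : MvPolynomial (Fin n) k) • v = 0) : ∃ m, IsMonomialLift k a v m := by
  have hp : 2 ≤ p := (Fact.out : p.Prime).two_le
  have H : ∀ N : ℕ, ∃ b : Fin n →₀ ℕ, (∀ i, N ≤ b i) ∧
      ∀ v : M, (∀ i, (X i : MvPolynomial (Fin n) k) • v = 0) → ∃ m, IsMonomialLift k b v m := by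
    intro N
    induction N with
    | zero =>
      refine ⟨0, fun i => Nat.zero_le _, fun v hv => ⟨v, ?_, fun a _ ha => ?_⟩⟩
      · rw [← C_apply, C_1, one_smul]
      · exact monomial_smul_eq_zero_of_X_smul_eq_zero hv ha 1
    | succ N ih =>
      obtain ⟨b, hb, hlift⟩ := ih
      refine ⟨p • b + topRem n p, fun i => ?_,
        fun v hv => hM.exists_isMonomialLift_frobenius hlift hv⟩
      rw [Finsupp.add_apply, Finsupp.smul_apply, topRem_apply, smul_eq_mul]
      have := hb i
      have : 1 * b i ≤ p * b i := Nat.mul_le_mul_right _ (by omega)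
      omega
  obtain ⟨b, hb, hlift⟩ := H a.degree
  obtain ⟨m, hm⟩ := hlift v hv
  exact ⟨_, hm.of_le fun i => (Finsupp.le_degree i a).trans (hb i)⟩

end Socle

/-! ### The classification -/

section Classification

open MvPolynomial InversePolynomial

variable {k : Type u} [Field k] {n : ℕ} {M : Type v} [AddCommGroup M]
  [Module (MvPolynomial (Fin n) k) M]

/-- A graded `F`-module supported on `𝔪` is the module of inverse polynomials with coefficients in
its socle. -/
theorem GradedFModuleStructure.exists_equiv_inversePolynomial {p : ℕ} [Fact p.Prime] [CharP k p]
    {ℳ : ℤ → AddSubgroup M} (hM : GradedFModuleStructure k n p ℳ)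
    (hnil : ∀ i x, ∃ N : ℕ, (X i : MvPolynomial (Fin n) k) ^ N • (x : M) = 0) :
    ∃ (ι : Type v) (Φ : M ≃ₗ[MvPolynomial (Fin n) k] InversePolynomial n (ι →₀ k)),
      ∀ d x, x ∈ ℳ d ↔ Φ x ∈ grading n (ι →₀ k) (n + d) := by
  have hG := hM.isGradedModule
  let : Module k M := constModule k n M
  let V : Submodule k M :=
    { carrier := {x | ∀ i, (X i : MvPolynomial (Fin n) k) • x = 0}
      zero_mem' := fun i => smul_zero _
      add_mem' := fun {x y} hx hy i => by rw [smul_add, hx, hy, add_zero]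
      smul_mem' := fun c x hx i => by
        change (X i : MvPolynomial (Fin n) k) • (C c : MvPolynomial (Fin n) k) • x = 0
        rw [smul_comm, hx, smul_zero] }
  let B := Module.Basis.ofVectorSpace k V
  obtain ⟨β, hβ⟩ := LinearMap.exists_extend B.repr.toLinearMap
  have hβV : ∀ v : V, β v = B.repr v := fun v => LinearMap.congr_fun hβ v
  let Φ := coind hG β.toAddMonoidHom (fun c x => β.map_smul c x) (-n)
  have hΦ : ∀ a x, coeff a (Φ x) = β (hG.proj (-n) ((monomial a (1 : k)) • x)) :=
    fun a x => rfl
  -- the socle is concentrated in degree `-n`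
  have hsoc : ∀ v ∈ V, hG.proj (-n) v = v := by
    intro v hv
    refine hG.ext_proj fun d => ?_
    rw [hG.proj_of_mem (hG.proj_mem _ v)]
    split_ifs with hd
    · rw [hd]
    · by_contra H
      exact hd (hM.degree_eq_of_X_smul_eq_zero (hG.proj_mem d v) (Ne.symm H)
        (hG.X_smul_proj_eq_zero hv d))
  -- every nonzero submodule meets the socle, where `Φ` is injective
  have hinj : Function.Injective Φ := by
    rw [injective_iff_map_eq_zero]
    intro x hx
    by_contra hx0
    obtain ⟨r, hr, hX⟩ := exists_smul_ne_zero_X_smul_eq_zero hx0 fun i => hnil i x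
    have h0 : coeff 0 (Φ (r • x)) = 0 := by rw [map_smul, hx, smul_zero, map_zero]
    rw [hΦ, ← C_apply, C_1, one_smul, hsoc _ hX, hβV ⟨r • x, hX⟩] at h0
    have := B.repr.map_eq_zero_iff.mp h0
    exact hr (congrArg Subtype.val this)
  have hsurj : Function.Surjective Φ := by
    intro f
    refine InversePolynomial.induction f (fun b w => ?_) ?_
    · obtain ⟨v, rfl⟩ := B.repr.surjective w
      obtain ⟨m, hm1, hm2⟩ := hM.exists_isMonomialLift b v.2
      -- the lift need not be homogeneous, but its component of the right degree maps to `w x⁻ᵇ`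
      refine ⟨hG.proj (-n - b.degree) m, InversePolynomial.ext fun a => ?_⟩
      rw [hΦ, hG.proj_monomial_smul, hG.proj_of_mem (hG.proj_mem _ m), coeff_single]
      by_cases hdeg : (a.degree : ℤ) = b.degree
      · rw [if_pos (by omega), ← hdeg, ← hG.proj_monomial_smul]
        split_ifs with hab
        · rw [hab, hm1, hsoc _ v.2, hβV]
        · rw [hm2 a (by omega) hab, map_zero, map_zero]
      · rw [if_neg (by omega), smul_zero, map_zero, if_neg]
        rintro rfl
        exact hdeg rfl
    · rintro f g ⟨x, rfl⟩ ⟨y, rfl⟩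
      exact ⟨x + y, map_add _ _ _⟩
  refine ⟨_, LinearEquiv.ofBijective Φ ⟨hinj, hsurj⟩, fun d x => ⟨fun hx => ?_, fun hx => ?_⟩⟩
  · have h := coind_mem hG β.toAddMonoidHom (fun c x => β.map_smul c x) (-n) hx
    rwa [show d - -(n : ℤ) = n + d by ring] at h
  · have hx' : Φ x ∈ grading n _ (n + d) := hx
    have : Φ (hG.proj d x) = Φ x := by
      refine InversePolynomial.ext fun a => ?_
      by_cases ha : -(n : ℤ) - a.degree = d
      · rw [hΦ, hΦ, hG.proj_monomial_smul, hG.proj_monomial_smul, ha,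
          hG.proj_same (hG.proj_mem d x)]
      · rw [hx' a (by omega), hΦ, hG.proj_monomial_smul, hG.proj_ne (hG.proj_mem d x) ha, smul_zero,
          map_zero]
    rw [← hinj this]
    exact hG.proj_mem d x

namespace InversePolynomial

/-- The map on inverse polynomials that applies a linear map to the coefficients. -/
noncomputable def map {V : Type v} {W : Type w} [AddCommGroup V] [Module k V] [AddCommGroup W]
    [Module k W] (g : V →ₗ[k] W) :
    InversePolynomial n V →ₗ[MvPolynomial (Fin n) k] InversePolynomial n W :=
  let G : InversePolynomial n V →+ InversePolynomial n W :=
    Finsupp.mapRange.addMonoidHom g.toAddMonoidHom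
  { G with
    map_smul' := map_smul_of_map_monomial_smul G fun a c f => ext fun e => by
      rw [coeff_monomial_smul]
      change g (coeff e ((monomial a c : MvPolynomial (Fin n) k) • f)) = c • g (coeff (e + a) f)
      rw [coeff_monomial_smul, map_smul] }

theorem coeff_map {V : Type v} {W : Type w} [AddCommGroup V] [Module k V] [AddCommGroup W]
    [Module k W] (g : V →ₗ[k] W) (a : Fin n →₀ ℕ) (f : InversePolynomial n V) :
    coeff a (map g f) = g (coeff a f) := rfl

/-- Inverse polynomials with coefficients in a free module form a direct sum of copies of
`k[x_1⁻¹, …, x_n⁻¹]`. -/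
theorem exists_equiv_directSum (k : Type u) [Field k] (n : ℕ) (ι : Type v) :
    ∃ Ψ : (⨁ _ : ι, InversePolynomial n k) ≃ₗ[MvPolynomial (Fin n) k]
      InversePolynomial n (ι →₀ k), ∀ g a i, coeff a (Ψ g) i = coeff a (g i) := by
  classical
  let F : ι → InversePolynomial n k →ₗ[MvPolynomial (Fin n) k] InversePolynomial n (ι →₀ k) :=
    fun i => map (Finsupp.lsingle i)
  let Ψ : (⨁ _ : ι, InversePolynomial n k) →ₗ[MvPolynomial (Fin n) k]
      InversePolynomial n (ι →₀ k) :=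
    DirectSum.toModule _ ι _ F
  have hof : ∀ i f, Ψ (DirectSum.lof (MvPolynomial (Fin n) k) ι _ i f) =
      map (Finsupp.lsingle i) f := fun i f =>
    DirectSum.toModule_lof (MvPolynomial (Fin n) k) (φ := F) i f
  have hΨ : ∀ g a i, coeff a (Ψ g) i = coeff a (g i) := by
    intro g a i
    induction g using DirectSum.induction_on with
    | zero => rw [map_zero, map_zero, DirectSum.zero_apply, map_zero]; rfl
    | of j f =>
      rw [← DirectSum.lof_eq_of (MvPolynomial (Fin n) k), hof, coeff_map, Finsupp.lsingle_apply,
        DirectSum.lof_eq_of]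
      by_cases hij : i = j
      · subst hij
        rw [Finsupp.single_eq_same, DirectSum.of_eq_same]
      · rw [Finsupp.single_eq_of_ne hij, DirectSum.of_eq_of_ne _ _ _ hij, map_zero]
    | add f g hf hg =>
      rw [map_add, map_add, Finsupp.add_apply, hf, hg, DirectSum.add_apply, map_add]
  refine ⟨LinearEquiv.ofBijective Ψ ⟨?_, ?_⟩, hΨ⟩
  · rw [injective_iff_map_eq_zero]
    intro g hg
    refine DFinsupp.ext fun i => ext fun a => ?_
    rw [← hΨ, hg, map_zero]
    exact (map_zero (coeff a)).symm
  · intro f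
    refine induction f (fun a v => ?_) ?_
    · refine Finsupp.induction_linear v ⟨0, by rw [map_zero, map_zero]⟩ ?_ fun i c => ?_
      · rintro v w ⟨g, hg⟩ ⟨h, hh⟩
        exact ⟨g + h, by rw [map_add, map_add, hg, hh]⟩
      · refine ⟨DirectSum.lof (MvPolynomial (Fin n) k) ι _ i (single a c), ?_⟩
        rw [hof]
        refine ext fun e => ?_
        rw [coeff_map, coeff_single, coeff_single]
        split_ifs
        · rfl
        · rw [map_zero]
    · rintro f g ⟨x, rfl⟩ ⟨y, rfl⟩
      exact ⟨x + y, map_add _ _ _⟩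

end InversePolynomial

end Classification

theorem theorem3p3 (k : Type u) [Field k] (p : ℕ) [Fact p.Prime] [CharP k p] (n : ℕ)
    (M : Type v) [AddCommGroup M] [Module (MvPolynomial (Fin n) k) M]
    (ℳ : ℤ → AddSubgroup M) (hM : GradedFModuleStructure k n p ℳ)
    (hsupp : ∀ P ∈ Module.support (MvPolynomial (Fin n) k) M,
      P.asIdeal = irrelevantIdeal k n) :
    (∃ (E : Type u) (_ : AddCommGroup E) (_ : Module (MvPolynomial (Fin n) k) E)
      (ℰ : ℤ → AddSubgroup E), IsStarE k n ℰ) ∧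
    ∀ (E : Type w) [AddCommGroup E] [Module (MvPolynomial (Fin n) k) E]
      (ℰ : ℤ → AddSubgroup E), IsStarE k n ℰ →
      ∃ (ι : Type v) (φ : M ≃ₗ[MvPolynomial (Fin n) k] ⨁ _ : ι, E),
        ∀ (d : ℤ) (x : M),
          x ∈ ℳ d ↔ φ x ∈ directSumGrading ι (shiftGrading ℰ (n : ℤ)) d := by
  refine ⟨⟨_, _, _, _, InversePolynomial.isStarE k n⟩, fun E _ _ ℰ hE => ?_⟩
  obtain ⟨ρ, hρ⟩ := hE.exists_equiv
  obtain ⟨ι, Φ, hΦ⟩ :=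
    hM.exists_equiv_inversePolynomial fun i x => X_pow_smul_eq_zero_of_support hsupp i x
  obtain ⟨Ψ, hΨ⟩ := InversePolynomial.exists_equiv_directSum k n ι
  let e : (⨁ _ : ι, InversePolynomial n k) ≃ₗ[MvPolynomial (Fin n) k] ⨁ _ : ι, E :=
    DFinsupp.mapRange.linearEquiv fun _ => ρ.symm
  have he : ∀ g i, e g i = ρ.symm (g i) := fun g i => rfl
  refine ⟨ι, Φ ≪≫ₗ Ψ.symm ≪≫ₗ e, fun d x => (hΦ d x).trans ?_⟩
  obtain ⟨g, hg⟩ := Ψ.surjective (Φ x)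
  have hφ : (Φ ≪≫ₗ Ψ.symm ≪≫ₗ e) x = e g := by
    rw [LinearEquiv.trans_apply, LinearEquiv.trans_apply, ← hg, Ψ.symm_apply_apply]
  rw [hφ, ← hg]
  change _ ↔ ∀ i, e g i ∈ ℰ (n + d)
  simp only [he, hρ, LinearEquiv.apply_symm_apply, InversePolynomial.mem_grading]
  refine ⟨fun h i a ha => ?_, fun h a ha => Finsupp.ext fun i => ?_⟩
  · rw [← hΨ, h a ha]
    rfl
  · rw [hΨ]
    exact h i a ha
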